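/- Let $\mathbf{F}_q$ be a finite field of characteristic $p$, let $n\ge 0$, and let $H=(\mathbf{C}^q)^{\otimes n}$ with orthonormal basis $|u\rangle$, $u\in\mathbf{F}_q^n$. Put $\omega=\exp(2\pi i/p)$ and let $\mathrm{tr}\colon\mathbf{F}_q\to\mathbf{F}_p$ be the trace. For $a,b\in\mathbf{F}_q^n$ let $X(a)=X(a_1)\otimes\cdots\otimes X(a_n)$ and $Z(b)=Z(b_1)\otimes\cdots\otimes Z(b_n)$, where $X(a_i)|x\rangle=|x+a_i\rangle$ and $Z(b_i)|x\rangle=\omega^{\mathrm{tr}(b_ix)}|x\rangle$ on $\mathbf{C}^q$. Let $E$ be the group generated by all $X(a)$ and $Z(b)$. For $(a|b)\in\mathbf{F}_q^{2n}$ let $\mathrm{swt}(a|b)$ be the number of $i$ with $a_i\ne0$ or $b_i\ne0$; for a set $S\subseteq \mathbf{F}_q^{2n}$ let $\mathrm{swt}(S)$ be the minimum of $\mathrm{swt}$ on $S$, with $\mathrm{swt}(\emptyset)=\infty$. The weight of an error $e=\alpha X(a)Z(b)\in E$ ($\alpha\neq 0$) is $\mathrm{swt}(a|b)$. For an additive subgroup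 $X\subseteq\mathbf{F}_q^{2n}$ let $X^{\perp_s}$ be the set of all $(a'|b')$ with $\mathrm{tr}(b\cdot a'-b'\cdot a)=0$ for all $(a|b)\in X$. An operator quantum error-correcting code is a subspace $C\subseteq H$ with a decomposition $C=A\otimes B$ as a tensor product of Hilbert spaces; let $P$ be the orthogonal projector onto $C$. An error $e$ is detectable by the subsystem $A$ if $PeP$ acts on $C=A\otimes B$ as $1_A\otimes g$ for some operator $g$ on $B$. The minimum distance of $A$ is the smallest weight of an error in $E$ that is not detectable by $A$ ($\infty$ if there is none). The subsystem $A$ can correct a set $S$ of errors if there is a quantum operation $R(\rho)=\sum_jR_j\rho R_j^\dagger$ with $\sum_jR_j^\dagger R_j=1$ such that for each $K$ in the linear span of $S$ and all positive semidefinite $\rho_A$ on $A$ and $\rho_B$ on $B$ one has $R(K(\rho_A\otimes\rho_B)K^\dagger)=\rho_A\otimes\tau_B$ for some positive semidefinite $\tau_B$ on $B$. **Theorem.** Let $X\neq\{0\}$ be any additive subgroup of $\mathbf{F}_q^{2n}$ and $Y=X\cap X^{\perp_s}$, with $x=|X|$ and $y=|Y|$. Then there is an operator quantum error-correcting code $C=A\otimes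 B\subseteq H$ with $\dim A=q^n/(xy)^{1/2}$ and $\dim B=(x/y)^{1/2}$ such that the minimum distance of the subsystem $A$ is $$d=\mathrm{swt}\bigl((X+X^{\perp_s})\setminus X\bigr)=\mathrm{swt}\bigl(Y^{\perp_s}\setminus X\bigr).$$ The subsystem $A$ detects every error in $E$ of weight less than $d$, and it can correct the set of all errors in $E$ of weight at most $\lfloor(d-1)/2\rfloor$ (if $d=\infty$: the set of all errors in $E$ of weight at most $t$, for every $t$). -/

import Mathlib

open scoped Kronecker Matrix ComplexOrder

noncomputable section

/-! ### The error group on `n` qudits of dimension `q = |F|` -/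

/-- The shift operator on `ℂ^q`, given by `|x⟩ ↦ |x + a⟩`. -/
def shiftOp {F : Type*} [Field F] [DecidableEq F] (a : F) : Matrix F F ℂ :=
  Matrix.of fun u v => if u = v + a then 1 else 0

/-- The phase operator on `ℂ^q`, given by `|x⟩ ↦ ω ^ tr (b x) |x⟩` with `ω = exp (2πi / p)`;
`ZMod.stdAddChar` is the map `j ↦ exp (2πi j / p)` on `ZMod p`. -/
def phaseOp (p : ℕ) [Fact p.Prime] {F : Type*} [Field F] [DecidableEq F] [Algebra (ZMod p) F]
    (b : F) : Matrix F F ℂ :=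
  Matrix.diagonal fun x => ZMod.stdAddChar (Algebra.trace (ZMod p) F (b * x))

/-- The tensor product `M 1 ⊗ ⋯ ⊗ M n`, acting on `(ℂ^q)^{⊗ n}` with its standard basis
`|u⟩ = |u 1⟩ ⊗ ⋯ ⊗ |u n⟩`, `u ∈ F^n`. -/
def tensorOp {F : Type*} {n : ℕ} (M : Fin n → Matrix F F ℂ) :
    Matrix (Fin n → F) (Fin n → F) ℂ :=
  Matrix.of fun u v => ∏ i, M i (u i) (v i)

theorem tensorOp_mem_unitaryGroup {F : Type*} [Fintype F] [DecidableEq F] {n : ℕ}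
    {M : Fin n → Matrix F F ℂ} (hM : ∀ i, M i ∈ Matrix.unitaryGroup F ℂ) :
    tensorOp M ∈ Matrix.unitaryGroup (Fin n → F) ℂ := by
  rw [Matrix.mem_unitaryGroup_iff]
  ext u v
  have h : ∀ i, ∑ w, M i (u i) w * star (M i (v i) w) = if u i = v i then 1 else 0 := by
    intro i
    have h1 := congrFun (congrFun (Matrix.mem_unitaryGroup_iff.1 (hM i)) (u i)) (v i)
    simpa [Matrix.mul_apply, Matrix.one_apply] using h1
  calc (tensorOp M * star (tensorOp M)) u v
      = ∑ w : Fin n → F, ∏ i, M i (u i) (w i) * star (M i (v i) (w i)) := by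
        simp [Matrix.mul_apply, tensorOp, Finset.prod_mul_distrib]
    _ = ∏ i, ∑ w, M i (u i) w * star (M i (v i) w) := by
        rw [Finset.prod_univ_sum, Fintype.piFinset_univ]
    _ = (1 : Matrix (Fin n → F) (Fin n → F) ℂ) u v := by
        simp only [h, Matrix.one_apply, funext_iff]
        by_cases huv : ∀ i, u i = v i
        · simp [huv]
        · rw [if_neg huv]
          obtain ⟨i, hi⟩ := not_forall.1 huv
          exact Finset.prod_eq_zero (Finset.mem_univ i) (if_neg hi)

theorem shiftOp_mem_unitaryGroup {F : Type*} [Field F] [Fintype F] [DecidableEq F] (a : F) :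
    shiftOp a ∈ Matrix.unitaryGroup F ℂ := by
  rw [Matrix.mem_unitaryGroup_iff]
  ext u v
  rw [Matrix.mul_apply, Finset.sum_eq_single (u - a)]
  · simp [shiftOp, Matrix.one_apply, eq_comm]
  · intro w _ hw
    have : u ≠ w + a := fun h => hw (by rw [h]; ring)
    simp [shiftOp, this]
  · simp

theorem phaseOp_mem_unitaryGroup (p : ℕ) [Fact p.Prime] {F : Type*} [Field F] [Fintype F]
    [DecidableEq F] [Algebra (ZMod p) F] (b : F) :
    phaseOp p b ∈ Matrix.unitaryGroup F ℂ := by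
  rw [Matrix.mem_unitaryGroup_iff, phaseOp, Matrix.star_eq_conjTranspose,
    Matrix.diagonal_conjTranspose, Matrix.diagonal_mul_diagonal, ← Matrix.diagonal_one]
  congr 1
  funext x
  simp [Complex.mul_conj, Complex.normSq_eq_norm_sq, AddChar.norm_apply]

/-- The error operator `X(a) = X(a_1) ⊗ ⋯ ⊗ X(a_n)`. -/
def errX {F : Type*} [Field F] [Fintype F] [DecidableEq F] {n : ℕ} (a : Fin n → F) :
    Matrix.unitaryGroup (Fin n → F) ℂ :=
  ⟨tensorOp fun i => shiftOp (a i),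
    tensorOp_mem_unitaryGroup fun i => shiftOp_mem_unitaryGroup (a i)⟩

/-- The error operator `Z(b) = Z(b_1) ⊗ ⋯ ⊗ Z(b_n)`. -/
def errZ (p : ℕ) [Fact p.Prime] {F : Type*} [Field F] [Fintype F] [DecidableEq F]
    [Algebra (ZMod p) F] {n : ℕ} (b : Fin n → F) : Matrix.unitaryGroup (Fin n → F) ℂ :=
  ⟨tensorOp fun i => phaseOp p (b i),
    tensorOp_mem_unitaryGroup fun i => phaseOp_mem_unitaryGroup p (b i)⟩

/-- The error group `E = ⟨X(a), Z(b) | a, b ∈ F^n⟩`. -/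
def errorGroup (p : ℕ) [Fact p.Prime] (F : Type*) [Field F] [Fintype F] [DecidableEq F]
    [Algebra (ZMod p) F] (n : ℕ) : Subgroup (Matrix.unitaryGroup (Fin n → F) ℂ) :=
  Subgroup.closure (Set.range errX ∪ Set.range (errZ p))

/-! ### Weights and the symplectic form on `F^{2n}` -/

/-- The symplectic weight of `(a|b)`: the number of `i` with `a_i ≠ 0` or `b_i ≠ 0`. -/
def swt {F : Type*} [Field F] [DecidableEq F] {n : ℕ} (v : (Fin n → F) × (Fin n → F)) : ℕ :=
  (Finset.univ.filter fun i => v.1 i ≠ 0 ∨ v.2 i ≠ 0).card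

/-- The minimum symplectic weight of a set of vectors (`⊤` for the empty set). -/
def swtMin {F : Type*} [Field F] [DecidableEq F] {n : ℕ}
    (S : Set ((Fin n → F) × (Fin n → F))) : ℕ∞ :=
  ⨅ v ∈ S, (swt v : ℕ∞)

/-- The weight of an error `e = α X(a) Z(b)`, `α ≠ 0`, namely `swt (a|b)`.
Every `e ∈ E` has such an expression, in which `(a|b)` is unique, so that the set below is a
singleton; for matrices not of this form the value is irrelevant. -/
def errWeight (p : ℕ) [Fact p.Prime] {F : Type*} [Field F] [Fintype F] [DecidableEq F]
    [Algebra (ZMod p) F] {n : ℕ} (e : Matrix (Fin n → F) (Fin n → F) ℂ) : ℕ :=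
  sInf {w | ∃ (α : ℂ) (a b : Fin n → F), α ≠ 0 ∧
    e = α • ((errX a * errZ p b : Matrix.unitaryGroup (Fin n → F) ℂ) :
      Matrix (Fin n → F) (Fin n → F) ℂ) ∧ w = swt (a, b)}

/-- The symplectic form `s((a|b), (a'|b')) = tr (b · a' - b' · a)` with values in `F_p`. It
describes commutators in `E`: for `e = X(a) Z(b)` and `e' = X(a') Z(b')`,
`e⁻¹ e'⁻¹ e e' = ω ^ s((a|b), (a'|b'))`. -/
def sform (p : ℕ) [Fact p.Prime] {F : Type*} [Field F] [Algebra (ZMod p) F] {n : ℕ}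
    (u v : (Fin n → F) × (Fin n → F)) : ZMod p :=
  Algebra.trace (ZMod p) F (u.2 ⬝ᵥ v.1 - v.2 ⬝ᵥ u.1)

/-- The symplectic dual `X^{⊥_s}` of an additive code `X ⊆ F^{2n}`. -/
def sdual (p : ℕ) [Fact p.Prime] {F : Type*} [Field F] [Algebra (ZMod p) F] {n : ℕ}
    (X : AddSubgroup ((Fin n → F) × (Fin n → F))) :
    AddSubgroup ((Fin n → F) × (Fin n → F)) where
  carrier := {v | ∀ u ∈ X, sform p u v = 0}
  zero_mem' := by
    intro u _
    simp [sform]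
  add_mem' := by
    intro v w hv hw u hu
    have h1 := hv u hu
    have h2 := hw u hu
    have h3 : u.2 ⬝ᵥ (v + w).1 - (v + w).2 ⬝ᵥ u.1
        = (u.2 ⬝ᵥ v.1 - v.2 ⬝ᵥ u.1) + (u.2 ⬝ᵥ w.1 - w.2 ⬝ᵥ u.1) := by
      simp only [Prod.fst_add, Prod.snd_add, dotProduct_add, add_dotProduct]
      ring
    simp only [sform] at h1 h2 ⊢
    rw [h3, map_add, h1, h2, add_zero]
  neg_mem' := by
    intro v hv u hu
    have h1 := hv u hu
    have h3 : u.2 ⬝ᵥ (-v).1 - (-v).2 ⬝ᵥ u.1 = -(u.2 ⬝ᵥ v.1 - v.2 ⬝ᵥ u.1) := by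
      simp only [Prod.fst_neg, Prod.snd_neg, dotProduct_neg, neg_dotProduct]
      ring
    simp only [sform] at h1 ⊢
    rw [h3, map_neg, h1, neg_zero]

/-! ### Operator quantum error-correcting codes -/

/-- An operator quantum error-correcting code in the Hilbert space `H = ℂ^ι`: a subspace `C` of
`H` together with a decomposition `C = A ⊗ B`, so that `H = (A ⊗ B) ⊕ C^⊥`. It is given by an
isometry `enc` from `A ⊗ B = ℂ^dimA ⊗ ℂ^dimB` onto `C ⊆ H`. -/
structure OQECC (ι : Type*) [Fintype ι] [DecidableEq ι] where
  /-- The dimension of the subsystem `A`. -/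
  dimA : ℕ
  /-- The dimension of the co-subsystem `B`. -/
  dimB : ℕ
  /-- The isometric embedding `A ⊗ B → H` with image `C`. -/
  enc : Matrix ι (Fin dimA × Fin dimB) ℂ
  isometry : encᴴ * enc = 1

namespace OQECC

variable {ι : Type*} [Fintype ι] [DecidableEq ι]

/-- The operator on `H` that acts as `T` on `C = A ⊗ B` and as `0` on `C^⊥`. -/
def lift (C : OQECC ι) (T : Matrix (Fin C.dimA × Fin C.dimB) (Fin C.dimA × Fin C.dimB) ℂ) :
    Matrix ι ι ℂ :=
  C.enc * T * C.encᴴ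

/-- The orthogonal projector `P` onto `C`. -/
def proj (C : OQECC ι) : Matrix ι ι ℂ := C.lift 1

/-- The error `e` is detectable by the subsystem `A`: the compression `P e P` to `C = A ⊗ B` is of
the form `1 ⊗ g`, that is, it acts by a scalar on `A` and arbitrarily on `B`
(this includes the errors that map `C` into `C^⊥`, for which `P e P = 0`). -/
def Detects (C : OQECC ι) (e : Matrix ι ι ℂ) : Prop :=
  ∃ g : Matrix (Fin C.dimB) (Fin C.dimB) ℂ,
    C.proj * e * C.proj = C.lift ((1 : Matrix (Fin C.dimA) (Fin C.dimA) ℂ) ⊗ₖ g)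

/-- The subsystem `A` can correct the set `S` of errors: there is a quantum operation
`ρ ↦ ∑ j, R_j ρ R_jᴴ` with `∑ j, R_jᴴ R_j = 1`, not depending on the error or on the state, that
restores the state of `A` after the action of every linear combination `K` of errors in `S`,
whatever happens to `B`. States are not normalized here, and the condition is additive in
`K ρ Kᴴ`, hence covers all noise processes `ρ ↦ ∑ i, K_i ρ K_iᴴ` with all `K_i` in the span. -/
def Corrects (C : OQECC ι) (S : Set (Matrix ι ι ℂ)) : Prop :=
  ∃ (m : ℕ) (R : Fin m → Matrix ι ι ℂ), ∑ j, (R j)ᴴ * R j = 1 ∧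
    ∀ K ∈ Submodule.span ℂ S,
      ∀ (ρA : Matrix (Fin C.dimA) (Fin C.dimA) ℂ) (ρB : Matrix (Fin C.dimB) (Fin C.dimB) ℂ),
        ρA.PosSemidef → ρB.PosSemidef →
          ∃ τB : Matrix (Fin C.dimB) (Fin C.dimB) ℂ, τB.PosSemidef ∧
            ∑ j, R j * (K * C.lift (ρA ⊗ₖ ρB) * Kᴴ) * (R j)ᴴ = C.lift (ρA ⊗ₖ τB)

/-- The minimum distance of the subsystem `A`: the smallest weight of an error in `E` that is not
detectable by `A` (`⊤` if all errors in `E` are detectable). -/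
def minDist (p : ℕ) [Fact p.Prime] {F : Type*} [Field F] [Fintype F] [DecidableEq F]
    [Algebra (ZMod p) F] {n : ℕ} (C : OQECC (Fin n → F)) : ℕ∞ :=
  ⨅ e ∈ {e : Matrix.unitaryGroup (Fin n → F) ℂ |
    e ∈ errorGroup p F n ∧ ¬ C.Detects (e : Matrix (Fin n → F) (Fin n → F) ℂ)},
    (errWeight p (e : Matrix (Fin n → F) (Fin n → F) ℂ) : ℕ∞)

end OQECC

end

open scoped Kronecker Matrix ComplexOrder

noncomputable section

/-! ### Symplectic duality and isotropic subgroups. -/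

section Symplectic

variable {p : ℕ} [Fact p.Prime] {F : Type*} [Field F] [Algebra (ZMod p) F] {n : ℕ}

/-! Choose a subgroup `L` with `Y ≤ L ≤ X` that is maximal among the isotropic ones
(`exists_maximal_isotropic`). Maximality gives `X ∩ L^⊥ = L`, and a count of character sums gives
`|L|² = |X||Y|`. The operators `weyl p l`, `l ∈ L`, commute; a joint eigenspace of theirs, the range
of an isometry `f`, has dimension `q^n / |L|` (`exists_joint_eigenbasis`). This is `A`.
Representatives `σ i` of `X / L` move it to pairwise orthogonal copies, since a nonzero class of `X
/ L` lies outside `L^⊥`. The sum of the copies is `C`, and `B` has the copies as its basis, so `dim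
B = |X| / |L|`.

In this basis the block `(i, j)` of the compression of `weyl p v` is, up to a phase, `fᴴ * weyl p u
* f` with `u = v + σ j - σ i`. It is scalar if `u ∈ L`, zero if `u ∉ L^⊥`, and for `u ∈ L^⊥ \ L` it
is traceless and unitary, hence not scalar. So `v` is undetectable exactly when some `u` lies in
`L^⊥ \ L`, which amounts to `v ∈ (X + X^⊥) \ X` (`exists_code_detects_iff`); here `X + X^⊥ = Y^⊥` by
double duality.

Correction is a Knill–Laflamme argument for subsystems (`corrects_range_of_forall_detects`): if all
products `(E i)ᴴ * E j` are detectable, diagonalizing their Gram matrix on `B` and the error index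
yields orthogonal scaled copies of `A`, which can be measured and mapped back. -/

theorem sform_add_left (u v w : (Fin n → F) × (Fin n → F)) :
    sform p (u + v) w = sform p u w + sform p v w := by
  simp only [sform, Prod.fst_add, Prod.snd_add, dotProduct_add, add_dotProduct, ← map_add]
  congr 1; ring

theorem sform_swap (u v : (Fin n → F) × (Fin n → F)) : sform p v u = -sform p u v := by
  simp only [sform, ← map_neg]
  congr 1; ring

theorem sform_add_right (u v w : (Fin n → F) × (Fin n → F)) :
    sform p u (v + w) = sform p u v + sform p u w := by
  rw [sform_swap, sform_add_left, sform_swap u v, sform_swap u w]; ring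

theorem sform_self (u : (Fin n → F) × (Fin n → F)) : sform p u u = 0 := by
  simp [sform]

/-- The symplectic form as an additive map in its second argument. -/
def sformHom (p : ℕ) [Fact p.Prime] {F : Type*} [Field F] [Algebra (ZMod p) F] {n : ℕ}
    (u : (Fin n → F) × (Fin n → F)) : (Fin n → F) × (Fin n → F) →+ ZMod p :=
  AddMonoidHom.mk' (sform p u) (sform_add_right u)

@[simp] theorem sformHom_apply (u v : (Fin n → F) × (Fin n → F)) :
    sformHom p u v = sform p u v := rfl

theorem mem_sdual {X : AddSubgroup ((Fin n → F) × (Fin n → F))}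
    {v : (Fin n → F) × (Fin n → F)} : v ∈ sdual p X ↔ ∀ u ∈ X, sform p u v = 0 := Iff.rfl

theorem le_sdual_comm {X L : AddSubgroup ((Fin n → F) × (Fin n → F))} :
    X ≤ sdual p L ↔ L ≤ sdual p X := by
  constructor <;>
  · intro h v hv u hu
    rw [sform_swap, neg_eq_zero]
    exact h hu v hv

theorem sdual_anti {X L : AddSubgroup ((Fin n → F) × (Fin n → F))} (h : X ≤ L) :
    sdual p L ≤ sdual p X := fun _ hv u hu => hv u (h hu)

theorem sdual_sup (X L : AddSubgroup ((Fin n → F) × (Fin n → F))) :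
    sdual p (X ⊔ L) = sdual p X ⊓ sdual p L := by
  apply le_antisymm
  · exact le_inf (sdual_anti le_sup_left) (sdual_anti le_sup_right)
  · rw [← le_sdual_comm]
    exact sup_le (le_sdual_comm.1 inf_le_left) (le_sdual_comm.1 inf_le_right)

theorem stdAddChar_sum_eq_prod {κ : Type*} (s : Finset κ) (f : κ → ZMod p) :
    (ZMod.stdAddChar (∑ i ∈ s, f i) : ℂ) = ∏ i ∈ s, ZMod.stdAddChar (f i) := by
  classical
  induction s using Finset.induction_on with
  | empty => simp
  | insert a s ha ih =>
    rw [Finset.sum_insert ha, Finset.prod_insert ha, AddChar.map_add_eq_mul, ih]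

/-- Orthogonality of characters; injectivity of `ZMod.stdAddChar` turns triviality of the character
into `f = 0`. -/
theorem sum_stdAddChar {A : Type*} [AddGroup A] [Fintype A] (f : A →+ ZMod p) [Decidable (f = 0)] :
    ∑ a, ZMod.stdAddChar (f a) = if f = 0 then (Fintype.card A : ℂ) else 0 := by
  classical
  have h := AddChar.sum_eq_ite (ZMod.stdAddChar.compAddMonoidHom f)
  simp only [AddChar.compAddMonoidHom_apply] at h
  rw [h]
  refine if_congr ⟨fun h => ?_, fun h => ?_⟩ rfl rfl
  · ext a
    apply ZMod.injective_stdAddChar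
    have := DFunLike.congr_fun h a
    simpa using this
  · ext a
    simp [h]

variable [Fintype F]

/-- Nondegeneracy of the trace form comes from surjectivity of the trace of a finite field over its
prime field. -/
theorem exists_trace_mul_ne_zero {a : F} (ha : a ≠ 0) :
    ∃ b : F, Algebra.trace (ZMod p) F (a * b) ≠ 0 := by
  have : FiniteDimensional (ZMod p) F := Module.Finite.of_finite
  obtain ⟨c, hc⟩ := Algebra.trace_surjective (ZMod p) F 1
  refine ⟨a⁻¹ * c, ?_⟩
  rw [mul_inv_cancel_left₀ ha, hc]
  exact one_ne_zero

theorem exists_trace_dotProduct_ne_zero {b : Fin n → F} (hb : b ≠ 0) :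
    ∃ w : Fin n → F, Algebra.trace (ZMod p) F (b ⬝ᵥ w) ≠ 0 := by
  obtain ⟨i, hi⟩ := Function.ne_iff.1 hb
  obtain ⟨c, hc⟩ := exists_trace_mul_ne_zero (p := p) hi
  exact ⟨Pi.single i c, by simpa using hc⟩

theorem sdual_top : sdual p (⊤ : AddSubgroup ((Fin n → F) × (Fin n → F))) = ⊥ := by
  rw [eq_bot_iff]
  intro v hv
  rw [AddSubgroup.mem_bot]
  refine Prod.ext ?_ ?_
  · by_contra h
    obtain ⟨w, hw⟩ := exists_trace_dotProduct_ne_zero (p := p) h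
    have := hv (0, w) trivial
    simp [sform, dotProduct_comm w] at this
    exact hw this
  · by_contra h
    obtain ⟨w, hw⟩ := exists_trace_dotProduct_ne_zero (p := p) h
    have := hv (w, 0) trivial
    simp [sform] at this
    exact hw this

/-- Sum `ω ^ s(u, v)` over `U × L` in both orders. Each inner sum vanishes unless its character is
trivial, which is a duality condition. Exchanging the arguments of `s` conjugates the sum, and this
is harmless because its value is a natural number. -/
theorem card_mul_card_inf_sdual (U L : AddSubgroup ((Fin n → F) × (Fin n → F))) :
    Nat.card U * Nat.card (L ⊓ sdual p U : AddSubgroup _) =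
      Nat.card L * Nat.card (U ⊓ sdual p L : AddSubgroup _) := by
  classical
  have key : ∀ U L : AddSubgroup ((Fin n → F) × (Fin n → F)),
      ∑ u : U, ∑ v : L, ZMod.stdAddChar (sform p u.1 v.1) =
        (Nat.card L : ℂ) * Nat.card (U ⊓ sdual p L : AddSubgroup _) := by
    intro U L
    have h1 : ∀ u : U, ∑ v : L, ZMod.stdAddChar (sform p u.1 v.1) =
        if u.1 ∈ sdual p L then (Nat.card L : ℂ) else 0 := by
      intro u
      have := sum_stdAddChar ((sformHom p u.1).comp L.subtype)
      simp only [AddMonoidHom.comp_apply, AddSubgroup.coe_subtype, sformHom_apply] at this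
      rw [this, Nat.card_eq_fintype_card]
      refine if_congr ⟨fun h v hv => ?_, fun h => ?_⟩ rfl rfl
      · rw [sform_swap, neg_eq_zero]
        exact DFunLike.congr_fun h ⟨v, hv⟩
      · ext v
        change sform p u.1 v.1 = 0
        rw [sform_swap, neg_eq_zero]
        exact h v v.2
    rw [Finset.sum_congr rfl fun u _ => h1 u, ← Finset.sum_filter, Finset.sum_const, nsmul_eq_mul,
      mul_comm]
    congr 2
    rw [← Fintype.card_subtype, ← Nat.card_eq_fintype_card]
    exact Nat.card_congr
      ⟨fun u => ⟨u.1.1, u.1.2, u.2⟩, fun u => ⟨⟨u.1, u.2.1⟩, u.2.2⟩, fun _ => rfl, fun _ => rfl⟩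
  have h1 := key U L
  have h2 := congrArg (starRingEnd ℂ) (key L U)
  rw [Finset.sum_comm] at h2
  simp only [map_sum, map_mul, map_natCast, ← AddChar.map_neg_eq_conj, ← sform_swap] at h2
  rw [h1] at h2
  exact_mod_cast h2.symm

theorem card_mul_card_sdual (U : AddSubgroup ((Fin n → F) × (Fin n → F))) :
    Nat.card U * Nat.card (sdual p U) = Nat.card ((Fin n → F) × (Fin n → F)) := by
  have h := card_mul_card_inf_sdual (p := p) U ⊤
  rw [top_inf_eq, sdual_top, inf_bot_eq] at h
  simpa using h

/-- The inclusion of `U` in its double dual is formal; equality follows by counting. -/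
theorem sdual_sdual (U : AddSubgroup ((Fin n → F) × (Fin n → F))) :
    sdual p (sdual p U) = U := by
  symm
  apply SetLike.coe_injective
  refine Set.eq_of_subset_of_ncard_le (le_sdual_comm.1 le_rfl) (le_of_eq ?_) (Set.toFinite _)
  have h1 := card_mul_card_sdual (p := p) U
  have h2 := card_mul_card_sdual (p := p) (sdual p U)
  have : 0 < Nat.card (sdual p U) := Nat.card_pos
  have h3 : Nat.card (sdual p (sdual p U)) = Nat.card U :=
    Nat.eq_of_mul_eq_mul_left this (by rw [h2, ← h1, mul_comm])
  exact h3

theorem sdual_inf_sdual (X : AddSubgroup ((Fin n → F) × (Fin n → F))) :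
    sdual p (X ⊓ sdual p X) = X ⊔ sdual p X := by
  rw [← sdual_sdual (p := p) (X ⊔ sdual p X), sdual_sup, sdual_sdual, inf_comm]

/-- The set of isotropic subgroups between `Y` and `X` is finite and contains `Y`, so it has a
maximal member. -/
theorem exists_maximal_isotropic (X : AddSubgroup ((Fin n → F) × (Fin n → F))) :
    ∃ L : AddSubgroup ((Fin n → F) × (Fin n → F)), X ⊓ sdual p X ≤ L ∧ L ≤ X ∧
      X ⊓ sdual p L = L := by
  have hfin : {L : AddSubgroup ((Fin n → F) × (Fin n → F)) |
      X ⊓ sdual p X ≤ L ∧ L ≤ X ∧ L ≤ sdual p L}.Finite := Set.toFinite _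
  obtain ⟨L, hL⟩ := hfin.exists_maximal
    ⟨X ⊓ sdual p X, le_rfl, inf_le_left, inf_le_right.trans (sdual_anti inf_le_left)⟩
  obtain ⟨⟨h1, h2, h3⟩, hmax⟩ := hL
  refine ⟨L, h1, h2, le_antisymm ?_ (le_inf h2 h3)⟩
  rintro v ⟨hvX, hvL⟩
  -- Since the form is alternating, `v` is orthogonal to itself as well as to `L`, so adjoining it
  -- keeps the subgroup isotropic; maximality then puts it in `L`.
  have hz : AddSubgroup.zmultiples v ≤ sdual p L := by simpa using hvL
  have hzz : AddSubgroup.zmultiples v ≤ sdual p (AddSubgroup.zmultiples v) := by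
    rw [AddSubgroup.zmultiples_le, ← SetLike.mem_coe]
    intro u hu
    have : AddSubgroup.zmultiples v ≤ (sformHom p v).ker := by simp [sform_self]
    rw [sform_swap, neg_eq_zero]
    exact this hu
  have := hmax (y := L ⊔ AddSubgroup.zmultiples v) ⟨h1.trans le_sup_left, sup_le h2 (by simpa using hvX), ?_⟩
    le_sup_left
  · exact this (AddSubgroup.mem_sup_right (AddSubgroup.mem_zmultiples v))
  · rw [sdual_sup]
    exact le_inf (sup_le h3 hz) (sup_le (le_sdual_comm.1 hz) hzz)

/-- The counting identity for the pair `L`, `X`, where `X ∩ L^⊥ = L` and `L ∩ X^⊥ = Y`. -/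
theorem card_sq_of_maximal_isotropic {X L : AddSubgroup ((Fin n → F) × (Fin n → F))}
    (h1 : X ⊓ sdual p X ≤ L) (h2 : L ≤ X) (h3 : X ⊓ sdual p L = L) :
    Nat.card L ^ 2 = Nat.card X * Nat.card (X ⊓ sdual p X : AddSubgroup _) := by
  have h := card_mul_card_inf_sdual (p := p) L X
  have h4 : L ⊓ sdual p X = X ⊓ sdual p X :=
    le_antisymm (inf_le_inf_right _ h2) (le_inf h1 inf_le_right)
  rw [h3, h4] at h
  rw [sq, h]

end Symplectic

/-! ### Symplectic weight. -/

section Weight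

variable {F : Type*} [Field F] [DecidableEq F] {n : ℕ}

theorem swt_add_le (u v : (Fin n → F) × (Fin n → F)) : swt (u + v) ≤ swt u + swt v := by
  refine le_trans (Finset.card_le_card ?_) (Finset.card_union_le _ _)
  intro i
  simp only [Finset.mem_filter, Finset.mem_univ, true_and, Finset.mem_union, Prod.fst_add,
    Prod.snd_add, Pi.add_apply]
  intro h
  by_contra! h'
  obtain ⟨⟨h1, h2⟩, h3, h4⟩ := h'
  simp [h1, h2, h3, h4] at h

theorem swt_neg (v : (Fin n → F) × (Fin n → F)) : swt (-v) = swt v := by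
  simp [swt]

end Weight

/-! ### The operators `X(a) Z(b)` and their common eigenvectors. -/

section Weyl

variable (p : ℕ) [Fact p.Prime] {F : Type*} [Field F] [Algebra (ZMod p) F] {n : ℕ}

/-- The phase in the product of `X(a) Z(b)` and `X(a') Z(b')`. -/
def weylPhase (u v : (Fin n → F) × (Fin n → F)) : ℂ :=
  ZMod.stdAddChar (Algebra.trace (ZMod p) F (u.2 ⬝ᵥ v.1))

theorem weylPhase_ne_zero (u v : (Fin n → F) × (Fin n → F)) : weylPhase p u v ≠ 0 := by
  have := AddChar.norm_apply ZMod.stdAddChar (Algebra.trace (ZMod p) F (u.2 ⬝ᵥ v.1))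
  intro h
  rw [weylPhase] at h
  rw [h] at this
  simp at this

theorem weylPhase_eq_sform_mul (u v : (Fin n → F) × (Fin n → F)) :
    weylPhase p u v = ZMod.stdAddChar (sform p u v) * weylPhase p v u := by
  rw [weylPhase, weylPhase, ← AddChar.map_add_eq_mul, sform, ← map_add, sub_add_cancel]

variable [DecidableEq F]

/-- The operator `X(a) Z(b)` as a matrix, for `v = (a|b)`. -/
def weyl (v : (Fin n → F) × (Fin n → F)) : Matrix (Fin n → F) (Fin n → F) ℂ :=
  Matrix.of fun u w => if u = w + v.1 then
    ZMod.stdAddChar (Algebra.trace (ZMod p) F (v.2 ⬝ᵥ w)) else 0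

@[simp] theorem weyl_zero : weyl p (0 : (Fin n → F) × (Fin n → F)) = 1 := by
  ext u w
  simp [weyl, Matrix.one_apply]

variable [Fintype F]

theorem coe_errX_mul_errZ (a b : Fin n → F) :
    ((errX a * errZ p b : Matrix.unitaryGroup (Fin n → F) ℂ) :
      Matrix (Fin n → F) (Fin n → F) ℂ) = weyl p (a, b) := by
  have hX : ((errX a : Matrix.unitaryGroup (Fin n → F) ℂ) : Matrix (Fin n → F) (Fin n → F) ℂ)
      = Matrix.of fun u w => if u = w + a then 1 else 0 := by
    ext u w
    simp only [errX, tensorOp, shiftOp, Matrix.of_apply, funext_iff, Pi.add_apply]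
    by_cases h : ∀ i, u i = w i + a i
    · simp [h]
    · rw [if_neg h]
      obtain ⟨i, hi⟩ := not_forall.1 h
      exact Finset.prod_eq_zero (Finset.mem_univ i) (if_neg hi)
  have hZ : ((errZ p b : Matrix.unitaryGroup (Fin n → F) ℂ) : Matrix (Fin n → F) (Fin n → F) ℂ)
      = Matrix.diagonal fun w => ZMod.stdAddChar (Algebra.trace (ZMod p) F (b ⬝ᵥ w)) := by
    ext u w
    simp only [errZ, tensorOp, phaseOp, Matrix.of_apply, Matrix.diagonal_apply, funext_iff]
    by_cases h : ∀ i, u i = w i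
    · simp only [h, implies_true, if_true, dotProduct, map_sum]
      rw [stdAddChar_sum_eq_prod]
    · rw [if_neg h]
      obtain ⟨i, hi⟩ := not_forall.1 h
      exact Finset.prod_eq_zero (Finset.mem_univ i) (if_neg hi)
  rw [Submonoid.coe_mul, hX, hZ]
  ext u w
  simp [weyl, Matrix.mul_diagonal]

theorem weyl_mul_weyl (u v : (Fin n → F) × (Fin n → F)) :
    weyl p u * weyl p v = weylPhase p u v • weyl p (u + v) := by
  ext x w
  rw [Matrix.mul_apply, Finset.sum_eq_single (w + v.1)]
  · simp only [weyl, Matrix.of_apply, Matrix.smul_apply, weylPhase, Prod.fst_add, Prod.snd_add,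
      smul_eq_mul, if_true, dotProduct_add, add_dotProduct, map_add, AddChar.map_add_eq_mul]
    by_cases h : x = w + v.1 + u.1
    · rw [if_pos h, if_pos (by rw [h]; abel)]; ring
    · rw [if_neg h, if_neg (fun h' => h (by rw [h']; abel))]; ring
  · intro y _ hy
    simp [weyl, hy]
  · simp

theorem weyl_conjTranspose_mul_self (v : (Fin n → F) × (Fin n → F)) :
    (weyl p v)ᴴ * weyl p v = 1 := by
  have h := Matrix.mem_unitaryGroup_iff'.1 (errX v.1 * errZ p v.2).2
  rwa [coe_errX_mul_errZ] at h

theorem weyl_conjTranspose (v : (Fin n → F) × (Fin n → F)) :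
    (weyl p v)ᴴ = weylPhase p v v • weyl p (-v) := by
  have h : weyl p v * (weylPhase p v v • weyl p (-v)) = 1 := by
    rw [Matrix.mul_smul, weyl_mul_weyl, add_neg_cancel, weyl_zero, smul_smul]
    have : weylPhase p v v * weylPhase p v (-v) = 1 := by
      rw [weylPhase, weylPhase, ← AddChar.map_add_eq_mul, ← map_add, Prod.fst_neg, dotProduct_neg,
        add_neg_cancel, map_zero, AddChar.map_zero_eq_one]
    rw [this, one_smul]
  calc (weyl p v)ᴴ = (weyl p v)ᴴ * (weyl p v * (weylPhase p v v • weyl p (-v))) := by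
        rw [h, mul_one]
    _ = _ := by rw [← mul_assoc, weyl_conjTranspose_mul_self, one_mul]

theorem weyl_commute (u v : (Fin n → F) × (Fin n → F)) :
    weyl p u * weyl p v = (ZMod.stdAddChar (sform p u v) : ℂ) • (weyl p v * weyl p u) := by
  rw [weyl_mul_weyl, weyl_mul_weyl, smul_smul, ← weylPhase_eq_sform_mul, add_comm]

/-- A nonzero shift leaves no diagonal entries; with zero shift the trace is a character sum. -/
theorem trace_weyl (v : (Fin n → F) × (Fin n → F)) :
    (weyl p v).trace = if v = 0 then (Fintype.card F : ℂ) ^ n else 0 := by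
  classical
  simp only [Matrix.trace, Matrix.diag_apply, weyl, Matrix.of_apply, left_eq_add]
  by_cases h1 : v.1 = 0
  · simp only [h1, if_true]
    have := sum_stdAddChar ((Algebra.trace (ZMod p) F).toAddMonoidHom.comp
      (AddMonoidHom.mk' (fun w : Fin n → F => v.2 ⬝ᵥ w) (dotProduct_add _)))
    simp only [AddMonoidHom.comp_apply, LinearMap.toAddMonoidHom_coe, AddMonoidHom.mk'_apply]
      at this
    rw [this]
    refine if_congr ⟨fun h => ?_, fun h => ?_⟩ (by simp) rfl
    · refine Prod.ext h1 ?_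
      by_contra h2
      obtain ⟨w, hw⟩ := exists_trace_dotProduct_ne_zero (p := p) h2
      exact hw (DFunLike.congr_fun h w)
    · ext w
      simp [h]
  · rw [if_neg (fun h => h1 (by rw [h]; rfl))]
    simp [h1]

/-- Distinct `weyl` operators are orthogonal for the trace inner product. This makes the weight of
an error well defined. -/
theorem eq_of_smul_weyl_eq {α β : ℂ} (hα : α ≠ 0) {u v : (Fin n → F) × (Fin n → F)}
    (h : α • weyl p u = β • weyl p v) : u = v := by
  by_contra huv
  have h2 := congrArg (fun M => ((weyl p u)ᴴ * M).trace) h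
  simp only [Matrix.mul_smul, weyl_conjTranspose_mul_self, Matrix.trace_smul] at h2
  rw [weyl_conjTranspose, Matrix.smul_mul, weyl_mul_weyl, Matrix.trace_smul, Matrix.trace_smul,
    trace_weyl, if_neg (fun h => huv (neg_add_eq_zero.1 h)), Matrix.trace_one] at h2
  simp [hα] at h2

theorem errWeight_smul_weyl {α : ℂ} (hα : α ≠ 0) (v : (Fin n → F) × (Fin n → F)) :
    errWeight p (α • weyl p v) = swt v := by
  have : {w | ∃ (β : ℂ) (a b : Fin n → F), β ≠ 0 ∧
    α • weyl p v = β • ((errX a * errZ p b : Matrix.unitaryGroup (Fin n → F) ℂ) :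
      Matrix (Fin n → F) (Fin n → F) ℂ) ∧ w = swt (a, b)} = {swt v} := by
    ext w
    constructor
    · rintro ⟨β, a, b, -, h, rfl⟩
      rw [coe_errX_mul_errZ] at h
      rw [eq_of_smul_weyl_eq p hα h]
      rfl
    · rintro rfl
      exact ⟨α, v.1, v.2, hα, by rw [coe_errX_mul_errZ], rfl⟩
  rw [errWeight, this, csInf_singleton]

theorem errWeight_weyl (v : (Fin n → F) × (Fin n → F)) : errWeight p (weyl p v) = swt v := by
  simpa using errWeight_smul_weyl p one_ne_zero v

theorem exists_mem_errorGroup_eq_weyl (v : (Fin n → F) × (Fin n → F)) :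
    ∃ e ∈ errorGroup p F n, (e : Matrix (Fin n → F) (Fin n → F) ℂ) = weyl p v :=
  ⟨errX v.1 * errZ p v.2, mul_mem (Subgroup.subset_closure (Or.inl ⟨_, rfl⟩))
    (Subgroup.subset_closure (Or.inr ⟨_, rfl⟩)), coe_errX_mul_errZ p _ _⟩

theorem exists_smul_weyl_of_mem_errorGroup {e : Matrix.unitaryGroup (Fin n → F) ℂ}
    (he : e ∈ errorGroup p F n) :
    ∃ (α : ℂ) (v : (Fin n → F) × (Fin n → F)), α ≠ 0 ∧
      (e : Matrix (Fin n → F) (Fin n → F) ℂ) = α • weyl p v := by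
  induction he using Subgroup.closure_induction with
  | mem x hx =>
    rcases hx with ⟨a, rfl⟩ | ⟨b, rfl⟩
    · refine ⟨1, (a, 0), one_ne_zero, ?_⟩
      rw [one_smul, ← coe_errX_mul_errZ, Submonoid.coe_mul]
      have : ((errZ p (0 : Fin n → F) : Matrix.unitaryGroup (Fin n → F) ℂ) :
          Matrix (Fin n → F) (Fin n → F) ℂ) = 1 := by
        ext u w
        simp only [errZ, tensorOp, phaseOp, Matrix.of_apply, Pi.zero_apply, zero_mul, map_zero,
          AddChar.map_zero_eq_one, Matrix.diagonal_one, Matrix.one_apply, funext_iff]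
        exact Finset.prod_ite_zero.trans (by simp)
      rw [this, mul_one]
    · refine ⟨1, (0, b), one_ne_zero, ?_⟩
      rw [one_smul, ← coe_errX_mul_errZ, Submonoid.coe_mul]
      have : ((errX (0 : Fin n → F) : Matrix.unitaryGroup (Fin n → F) ℂ) :
          Matrix (Fin n → F) (Fin n → F) ℂ) = 1 := by
        ext u w
        simp only [errX, tensorOp, shiftOp, Matrix.of_apply, Pi.zero_apply, add_zero,
          Matrix.one_apply, funext_iff]
        exact Finset.prod_ite_zero.trans (by simp)
      rw [this, one_mul]
  | one => exact ⟨1, 0, one_ne_zero, by simp⟩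
  | mul x y _ _ hx hy =>
    obtain ⟨α, u, hα, hx⟩ := hx
    obtain ⟨β, v, hβ, hy⟩ := hy
    refine ⟨α * (β * weylPhase p u v), u + v,
      mul_ne_zero hα (mul_ne_zero hβ (weylPhase_ne_zero p u v)), ?_⟩
    rw [Submonoid.coe_mul, hx, hy, Matrix.smul_mul, Matrix.mul_smul, weyl_mul_weyl, smul_smul,
      smul_smul, mul_assoc]
  | inv x _ hx =>
    obtain ⟨α, u, hα, hx⟩ := hx
    refine ⟨star α * weylPhase p u u, -u, mul_ne_zero (star_ne_zero.2 hα)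
      (weylPhase_ne_zero p u u), ?_⟩
    have : ((x⁻¹ : Matrix.unitaryGroup (Fin n → F) ℂ) : Matrix (Fin n → F) (Fin n → F) ℂ) =
      (x : Matrix (Fin n → F) (Fin n → F) ℂ)ᴴ := rfl
    rw [this, hx, Matrix.conjTranspose_smul, weyl_conjTranspose, smul_smul]

/-- With `k = p` the vector `k • v` vanishes, so the `p`-th power is a nonzero scalar; this is what
makes the operators diagonalizable. -/
theorem exists_weyl_pow (v : (Fin n → F) × (Fin n → F)) (k : ℕ) :
    ∃ c : ℂ, c ≠ 0 ∧ weyl p v ^ k = c • weyl p (k • v) := by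
  induction k with
  | zero => exact ⟨1, one_ne_zero, by simp⟩
  | succ k ih =>
    obtain ⟨c, hc, h⟩ := ih
    refine ⟨c * weylPhase p (k • v) v, mul_ne_zero hc (weylPhase_ne_zero p _ _), ?_⟩
    rw [pow_succ, h, Matrix.smul_mul, weyl_mul_weyl, smul_smul, succ_nsmul]

/-- Pairwise commuting operators `X(a) Z(b)` have a common eigenvector, hence the eigenvalues
trivialize the phases. -/
theorem exists_eigenvalues_weyl {L : AddSubgroup ((Fin n → F) × (Fin n → F))}
    (hL : L ≤ sdual p L) :
    ∃ χ : (Fin n → F) × (Fin n → F) → ℂ, χ 0 = 1 ∧ (∀ u ∈ L, star (χ u) * χ u = 1) ∧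
      ∀ u ∈ L, ∀ v ∈ L, χ u * χ v = weylPhase p u v * χ (u + v) := by
  classical
  let f : L → Module.End ℂ ((Fin n → F) → ℂ) := fun l => Matrix.toLin' (weyl p l.1)
  have hcomm : Pairwise fun i j => Commute (f i) (f j) := by
    intro i j _
    have h : weyl p i.1 * weyl p j.1 = weyl p j.1 * weyl p i.1 := by
      rw [weyl_commute, hL j.2 i.1 i.2, AddChar.map_zero_eq_one, one_smul]
    change f i * f j = f j * f i
    rw [Module.End.mul_eq_comp, Module.End.mul_eq_comp, ← Matrix.toLin'_mul, ← Matrix.toLin'_mul, h]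
  -- Each operator is a root of `T ^ p - c` with `c ≠ 0`, which is separable over `ℂ`; generalized
  -- eigenspaces are therefore eigenspaces.
  have hss : ∀ l, (f l).IsFinitelySemisimple := by
    intro l
    obtain ⟨c, hc, h⟩ := exists_weyl_pow p l.1 p
    have hp : p • l.1 = 0 := by
      have : ∀ w : Fin n → F, p • w = 0 := by
        intro w
        ext i
        have : (p : F) = 0 := by
          rw [← map_natCast (algebraMap (ZMod p) F), ZMod.natCast_self, map_zero]
        simp [this]
      exact Prod.ext (this _) (this _)
    rw [hp, weyl_zero] at h
    have h' : (f l) ^ p = algebraMap ℂ _ c := by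
      rw [← Matrix.toLin'_pow, h, map_smul, Matrix.toLin'_one]; rfl
    have hsf : Squarefree (Polynomial.X ^ p - Polynomial.C c : Polynomial ℂ) :=
      (Polynomial.separable_X_pow_sub_C c
        (by exact_mod_cast (Fact.out : p.Prime).ne_zero) hc).squarefree
    exact (Module.End.isSemisimple_of_squarefree_aeval_eq_zero hsf
      (by simp [h'])).isFinitelySemisimple
  have htop := Module.End.iSup_iInf_maxGenEigenspace_eq_top_of_iSup_maxGenEigenspace_eq_top_of_commute
    f hcomm fun i => Module.End.iSup_maxGenEigenspace_eq_top _
  -- The joint generalized eigenspaces of the commuting family span a nonzero space, so one of them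
  -- is nonzero.
  have hne : ∃ χ : L → ℂ, ⨅ i, (f i).maxGenEigenspace (χ i) ≠ ⊥ := by
    by_contra! h
    rw [iSup_eq_bot.2 h] at htop
    exact bot_ne_top htop
  obtain ⟨χ, hχ⟩ := hne
  obtain ⟨x, hx, hx0⟩ := Submodule.exists_mem_ne_zero_of_ne_bot hχ
  have hev : ∀ l : L, weyl p l.1 *ᵥ x = χ l • x := by
    intro l
    have := (Submodule.mem_iInf _).1 hx l
    rw [(hss l).maxGenEigenspace_eq_eigenspace, Module.End.mem_eigenspace_iff] at this
    exact this
  -- The value `1` outside `L` is arbitrary; all claims concern `L` only.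
  refine ⟨fun v => if h : v ∈ L then χ ⟨v, h⟩ else 1, ?_, ?_, ?_⟩
  · simp only [dif_pos (zero_mem L)]
    have h1 := hev ⟨0, zero_mem L⟩
    rw [weyl_zero, Matrix.one_mulVec] at h1
    exact smul_left_injective ℂ hx0 (h1.symm.trans (one_smul ℂ x).symm)
  · intro u hu
    simp only [dif_pos hu]
    have h1 : star (weyl p u *ᵥ x) ⬝ᵥ (weyl p u *ᵥ x) = star x ⬝ᵥ x := by
      rw [Matrix.star_mulVec, Matrix.dotProduct_mulVec, Matrix.vecMul_vecMul,
        weyl_conjTranspose_mul_self, Matrix.vecMul_one]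
    rw [hev ⟨u, hu⟩, star_smul, smul_dotProduct, dotProduct_smul, smul_smul, smul_eq_mul] at h1
    have h2 : star x ⬝ᵥ x ≠ 0 := fun h => hx0 (dotProduct_star_self_eq_zero.1 h)
    exact mul_right_cancel₀ h2 (h1.trans (one_mul _).symm)
  · intro u hu v hv
    simp only [dif_pos hu, dif_pos hv, dif_pos (add_mem hu hv)]
    have h1 : (weyl p u * weyl p v) *ᵥ x = (χ ⟨u, hu⟩ * χ ⟨v, hv⟩) • x := by
      rw [← Matrix.mulVec_mulVec, hev ⟨v, hv⟩, Matrix.mulVec_smul, hev ⟨u, hu⟩, smul_smul, mul_comm]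
    rw [weyl_mul_weyl, Matrix.smul_mulVec, hev ⟨u + v, add_mem hu hv⟩, smul_smul] at h1
    exact (smul_left_injective ℂ hx0 h1).symm

end Weyl

/-! ### Detection and correction for subsystem codes. -/

namespace OQECC

variable {ι : Type*} [Fintype ι] [DecidableEq ι]

/-- Conjugation by the isometry `enc` passes between operators on `C` and matrices on `A ⊗ B`. -/
theorem detects_iff (C : OQECC ι) (e : Matrix ι ι ℂ) :
    C.Detects e ↔ ∃ g : Matrix (Fin C.dimB) (Fin C.dimB) ℂ,
      C.encᴴ * e * C.enc = (1 : Matrix (Fin C.dimA) (Fin C.dimA) ℂ) ⊗ₖ g := by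
  refine exists_congr fun g => ⟨fun h => ?_, fun h => ?_⟩
  · have h' := congrArg (fun M => C.encᴴ * M * C.enc) h
    simp only [proj, lift, Matrix.mul_one] at h'
    have e1 : C.encᴴ * (C.enc * C.encᴴ * e * (C.enc * C.encᴴ)) * C.enc =
        (C.encᴴ * C.enc) * (C.encᴴ * e * C.enc) * (C.encᴴ * C.enc) := by
      simp only [Matrix.mul_assoc]
    have e2 : C.encᴴ * (C.enc * ((1 : Matrix (Fin C.dimA) (Fin C.dimA) ℂ) ⊗ₖ g) * C.encᴴ) * C.enc =
        (C.encᴴ * C.enc) * ((1 : Matrix (Fin C.dimA) (Fin C.dimA) ℂ) ⊗ₖ g) * (C.encᴴ * C.enc) := by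
      simp only [Matrix.mul_assoc]
    rw [e1, e2, C.isometry] at h'
    simpa only [Matrix.one_mul, Matrix.mul_one] using h'
  · simp only [proj, lift, Matrix.mul_one, ← h, Matrix.mul_assoc]

theorem Detects.smul {C : OQECC ι} {e : Matrix ι ι ℂ} (h : C.Detects e) (α : ℂ) :
    C.Detects (α • e) := by
  rw [detects_iff] at h ⊢
  obtain ⟨g, hg⟩ := h
  exact ⟨α • g, by rw [Matrix.mul_smul, Matrix.smul_mul, hg, Matrix.kronecker_smul]⟩

theorem detects_smul_iff (C : OQECC ι) {α : ℂ} (hα : α ≠ 0) (e : Matrix ι ι ℂ) :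
    C.Detects (α • e) ↔ C.Detects e :=
  ⟨fun h => by simpa [smul_smul, hα] using h.smul α⁻¹, fun h => h.smul α⟩

/-- A family of operators recovers the subsystem `A` from the errors in the span of `S` if every
recovery operator, applied after an error in `S`, acts on the code as `1 ⊗ N`. -/
theorem corrects_of_forall_exists (C : OQECC ι) (S : Set (Matrix ι ι ℂ)) {κ : Type*} [Fintype κ]
    (R : κ → Matrix ι ι ℂ) (hR : ∑ k, (R k)ᴴ * R k = 1)
    (h : ∀ k, ∀ K ∈ S, ∃ N : Matrix (Fin C.dimB) (Fin C.dimB) ℂ,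
      R k * K * C.enc = C.enc * ((1 : Matrix (Fin C.dimA) (Fin C.dimA) ℂ) ⊗ₖ N)) :
    C.Corrects S := by
  classical
  let e := Fintype.equivFin κ
  refine ⟨Fintype.card κ, fun j => R (e.symm j), ?_, ?_⟩
  · rw [← hR]
    exact Equiv.sum_comp e.symm fun k => (R k)ᴴ * R k
  intro K hK ρA ρB hA hB
  have hN : ∀ k, ∃ N : Matrix (Fin C.dimB) (Fin C.dimB) ℂ,
      R k * K * C.enc = C.enc * ((1 : Matrix (Fin C.dimA) (Fin C.dimA) ℂ) ⊗ₖ N) := by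
    intro k
    induction hK using Submodule.span_induction with
    | mem x hx => exact h k x hx
    | zero => exact ⟨0, by simp⟩
    | add x y _ _ hx hy =>
      obtain ⟨N, hN⟩ := hx
      obtain ⟨N', hN'⟩ := hy
      exact ⟨N + N', by rw [Matrix.mul_add, Matrix.add_mul, hN, hN', Matrix.kronecker_add,
        Matrix.mul_add]⟩
    | smul a x _ hx =>
      obtain ⟨N, hN⟩ := hx
      exact ⟨a • N, by rw [Matrix.mul_smul, Matrix.smul_mul, hN, Matrix.kronecker_smul,
        Matrix.mul_smul]⟩
  choose N hN using hN
  refine ⟨∑ k, N k * ρB * (N k)ᴴ,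
    Matrix.posSemidef_sum _ fun k _ => hB.mul_mul_conjTranspose_same (N k), ?_⟩
  have hterm : ∀ k, R k * (K * C.lift (ρA ⊗ₖ ρB) * Kᴴ) * (R k)ᴴ =
      C.lift (ρA ⊗ₖ (N k * ρB * (N k)ᴴ)) := by
    intro k
    calc R k * (K * C.lift (ρA ⊗ₖ ρB) * Kᴴ) * (R k)ᴴ
        = (R k * K * C.enc) * (ρA ⊗ₖ ρB) * (R k * K * C.enc)ᴴ := by
          simp only [lift, Matrix.conjTranspose_mul, Matrix.mul_assoc]
      _ = C.enc * (((1 : Matrix (Fin C.dimA) (Fin C.dimA) ℂ) ⊗ₖ N k) * (ρA ⊗ₖ ρB) *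
            ((1 : Matrix (Fin C.dimA) (Fin C.dimA) ℂ) ⊗ₖ N k)ᴴ) * C.encᴴ := by
          rw [hN]
          simp only [Matrix.conjTranspose_mul, Matrix.mul_assoc]
      _ = C.lift (ρA ⊗ₖ (N k * ρB * (N k)ᴴ)) := by
          rw [Matrix.conjTranspose_kronecker, ← Matrix.mul_kronecker_mul,
            ← Matrix.mul_kronecker_mul, Matrix.conjTranspose_one, Matrix.one_mul, Matrix.mul_one]
          rfl
  rw [Equiv.sum_comp e.symm fun k => R k * (K * C.lift (ρA ⊗ₖ ρB) * Kᴴ) * (R k)ᴴ]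
  simp only [hterm]
  have hsum : ρA ⊗ₖ (∑ k, N k * ρB * (N k)ᴴ) = ∑ k, ρA ⊗ₖ (N k * ρB * (N k)ᴴ) := by
    ext
    simp only [Matrix.kroneckerMap_apply, Matrix.sum_apply, Finset.mul_sum]
  simp only [lift, hsum, Matrix.mul_sum, Matrix.sum_mul]

end OQECC

section

variable {ι : Type*} [Fintype ι]

/-- Matrices `F k` with `(F k)ᴴ (F l) = 0` for `k ≠ l`, each a scaled isometry: after
normalization they are isometries with orthogonal ranges, or zero. -/
theorem exists_normalized_isometries {α κ : Type*} [Fintype α] [DecidableEq α] [Nonempty α]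
    [Fintype κ] [DecidableEq κ]
    (M : κ → Matrix ι α ℂ) (d : κ → ℝ)
    (h : ∀ k l, (M k)ᴴ * M l = if k = l then (d k : ℂ) • 1 else 0) :
    ∃ (G : κ → Matrix ι α ℂ) (c : κ → ℂ), (∀ l, (∑ k, G k * (G k)ᴴ) * M l = M l) ∧
      (∑ k, G k * (G k)ᴴ) * (∑ k, G k * (G k)ᴴ) = ∑ k, G k * (G k)ᴴ ∧
      ∀ k l, (G k)ᴴ * M l = if k = l then c k • 1 else 0 := by
  classical
  have hd : ∀ k, 0 ≤ d k := by
    intro k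
    obtain ⟨a⟩ := ‹Nonempty α›
    have h1 := (Matrix.posSemidef_conjTranspose_mul_self (M k)).diag_nonneg (i := a)
    rw [h k k, if_pos rfl] at h1
    simpa using h1
  have hM0 : ∀ k, d k = 0 → M k = 0 := by
    intro k hk
    have h1 := h k k
    rw [if_pos rfl, hk, Complex.ofReal_zero, zero_smul] at h1
    exact Matrix.conjTranspose_mul_self_eq_zero.1 h1
  -- If `d k = 0`, then `M k = 0` and the convention `0⁻¹ = 0` makes `G k` zero, so no case
  -- distinction is needed in the definition.
  let s : κ → ℂ := fun k => ((√(d k))⁻¹ : ℝ)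
  let G : κ → Matrix ι α ℂ := fun k => s k • M k
  have hs : ∀ k, star (s k) = s k := fun k => Complex.conj_ofReal _
  have hGM : ∀ k l, (G k)ᴴ * M l = if k = l then (s k * d k) • 1 else 0 := by
    intro k l
    simp only [G, Matrix.conjTranspose_smul, hs, Matrix.smul_mul, h]
    split_ifs
    · rw [smul_smul]
    · rw [smul_zero]
  have hfix : ∀ l, (∑ k, G k * (G k)ᴴ) * M l = M l := by
    intro l
    simp only [Matrix.sum_mul, Matrix.mul_assoc, hGM]
    rw [Finset.sum_eq_single l (fun k _ hk => by rw [if_neg hk, Matrix.mul_zero]) (by simp),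
      if_pos rfl, Matrix.mul_smul, Matrix.mul_one, smul_smul]
    rcases eq_or_ne (d l) 0 with h0 | h0
    · simp only [hM0 l h0, smul_zero]
    · have : s l * ↑(d l) * s l = 1 := by
        simp only [s]
        norm_cast
        have h2 : √(d l) ≠ 0 := (Real.sqrt_ne_zero (hd l)).2 h0
        have h3 := Real.mul_self_sqrt (hd l)
        field_simp
        rw [sq, h3]
      rw [this, one_smul]
  refine ⟨G, fun k => s k * d k, hfix, ?_, hGM⟩
  have hfixG : ∀ l, (∑ k, G k * (G k)ᴴ) * G l = G l := fun l => by
    rw [show G l = s l • M l from rfl, Matrix.mul_smul, hfix]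
  rw [Matrix.mul_sum]
  exact Finset.sum_congr rfl fun k _ => by rw [← Matrix.mul_assoc, hfixG]

end

namespace OQECC

variable {ι : Type*} [Fintype ι] [DecidableEq ι]

/-- Detectability of the products says that the columns of all `E i * enc`, regrouped as `A ⊗ (B ⊗
κ)`, have Gram matrix `1 ⊗ G`. A unitary change of basis `U` on `B ⊗ κ` diagonalizes `G`, so the
errors become combinations of maps `M k` from `A` that are scaled isometries with orthogonal ranges.
Recovery finds `k`, undoes `M k`, and resets `B` to a fixed basis state. -/
theorem corrects_range_of_forall_detects (C : OQECC ι) (hA : 0 < C.dimA) (hB : 0 < C.dimB)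
    {κ : Type*} [Fintype κ] (E : κ → Matrix ι ι ℂ) (hE : ∀ i j, C.Detects ((E i)ᴴ * E j)) :
    C.Corrects (Set.range E) := by
  classical
  simp only [detects_iff] at hE
  choose g hg using hE
  let a₀ : Fin C.dimA := ⟨0, hA⟩
  let b₀ : Fin C.dimB := ⟨0, hB⟩
  have : Nonempty (Fin C.dimA) := ⟨a₀⟩
  let W : Matrix ι (Fin C.dimA × (Fin C.dimB × κ)) ℂ :=
    Matrix.of fun u x => (E x.2.2 * C.enc) u (x.1, x.2.1)
  let G : Matrix (Fin C.dimB × κ) (Fin C.dimB × κ) ℂ :=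
    Matrix.of fun x y => g x.2 y.2 x.1 y.1
  have hW : Wᴴ * W = (1 : Matrix (Fin C.dimA) (Fin C.dimA) ℂ) ⊗ₖ G := by
    ext ⟨a, b, i⟩ ⟨a', b', j⟩
    have h := congrFun (congrFun (hg i j) (a, b)) (a', b')
    have e : C.encᴴ * ((E i)ᴴ * E j) * C.enc = (E i * C.enc)ᴴ * (E j * C.enc) := by
      simp only [Matrix.conjTranspose_mul, Matrix.mul_assoc]
    rw [e] at h
    simpa only [Matrix.mul_apply, Matrix.conjTranspose_apply, W, G, Matrix.of_apply,
      Matrix.kroneckerMap_apply] using h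
  have hG : G.IsHermitian := by
    ext x y
    have h := congrFun (congrFun (Matrix.isHermitian_conjTranspose_mul_self W).eq (a₀, x)) (a₀, y)
    rw [hW] at h
    simpa using h
  let U : Matrix (Fin C.dimB × κ) (Fin C.dimB × κ) ℂ := hG.eigenvectorUnitary
  have hU : Uᴴ * U = 1 := Matrix.mem_unitaryGroup_iff'.1 hG.eigenvectorUnitary.2
  have hU' : U * Uᴴ = 1 := Matrix.mem_unitaryGroup_iff.1 hG.eigenvectorUnitary.2
  have hspec : Uᴴ * G * U = Matrix.diagonal (fun k => (hG.eigenvalues k : ℂ)) := by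
    have h : G = U * Matrix.diagonal (fun k => (hG.eigenvalues k : ℂ)) * Uᴴ := by
      have := hG.spectral_theorem
      rw [Unitary.conjStarAlgAut_apply] at this
      exact this
    calc Uᴴ * G * U = Uᴴ * (U * Matrix.diagonal (fun k => (hG.eigenvalues k : ℂ)) * Uᴴ) * U := by
          rw [← h]
      _ = (Uᴴ * U) * Matrix.diagonal (fun k => (hG.eigenvalues k : ℂ)) * (Uᴴ * U) := by
          simp only [Matrix.mul_assoc]
      _ = _ := by rw [hU, Matrix.one_mul, Matrix.mul_one]
  let Mt := W * ((1 : Matrix (Fin C.dimA) (Fin C.dimA) ℂ) ⊗ₖ U)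
  have hMt : Mtᴴ * Mt = (1 : Matrix (Fin C.dimA) (Fin C.dimA) ℂ) ⊗ₖ
      Matrix.diagonal (fun k => (hG.eigenvalues k : ℂ)) := by
    calc Mtᴴ * Mt = ((1 : Matrix (Fin C.dimA) (Fin C.dimA) ℂ) ⊗ₖ U)ᴴ * (Wᴴ * W) *
          ((1 : Matrix (Fin C.dimA) (Fin C.dimA) ℂ) ⊗ₖ U) := by
          simp only [Mt, Matrix.conjTranspose_mul, Matrix.mul_assoc]
      _ = _ := by
          rw [hW, Matrix.conjTranspose_kronecker, ← Matrix.mul_kronecker_mul,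
            ← Matrix.mul_kronecker_mul, hspec]
          simp
  have hWM : W = Mt * ((1 : Matrix (Fin C.dimA) (Fin C.dimA) ℂ) ⊗ₖ Uᴴ) := by
    simp only [Mt]
    rw [Matrix.mul_assoc, ← Matrix.mul_kronecker_mul, hU', Matrix.one_mul,
      Matrix.one_kronecker_one, Matrix.mul_one]
  let M : Fin C.dimB × κ → Matrix ι (Fin C.dimA) ℂ := fun k => Matrix.of fun u a => Mt u (a, k)
  have hM : ∀ k l, (M k)ᴴ * M l = if k = l then (hG.eigenvalues k : ℂ) • 1 else 0 := by
    intro k l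
    ext a a'
    have h := congrFun (congrFun hMt (a, k)) (a', l)
    simp only [Matrix.kroneckerMap_apply, Matrix.diagonal_apply] at h
    rw [show ((M k)ᴴ * M l) a a' = (Mtᴴ * Mt) (a, k) (a', l) from rfl, hMt]
    simp only [Matrix.kroneckerMap_apply, Matrix.diagonal_apply]
    split_ifs <;> simp [mul_comm]
  obtain ⟨V, c, hV1, hV2, hV3⟩ := exists_normalized_isometries M hG.eigenvalues hM
  let Q := ∑ k, V k * (V k)ᴴ
  have hQ : Qᴴ = Q := by
    simp [Q, Matrix.conjTranspose_sum, Matrix.conjTranspose_mul]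
  -- `J` embeds `A` in the code as `A ⊗ b₀`.
  let J : Matrix ι (Fin C.dimA) ℂ := Matrix.of fun u a => C.enc u (a, b₀)
  have hJ : Jᴴ * J = 1 := by
    ext a a'
    have h := congrFun (congrFun C.isometry (a, b₀)) (a', b₀)
    rw [show (Jᴴ * J) a a' = (C.encᴴ * C.enc) (a, b₀) (a', b₀) from rfl, h]
    simp [Matrix.one_apply]
  have hEV : ∀ i, ∀ (u : ι) (a : Fin C.dimA) (b : Fin C.dimB),
      (E i * C.enc) u (a, b) = ∑ k, M k u a * star (U (b, i) k) := by
    intro i u a b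
    have h := congrFun (congrFun hWM u) (a, b, i)
    rw [show (E i * C.enc) u (a, b) = W u (a, b, i) from rfl, h, Matrix.mul_apply,
      Fintype.sum_prod_type, Finset.sum_eq_single a]
    · simp [M]
    · intro a' _ ha
      simp [ha]
    · simp
  -- The extra operator `1 - Q` completes the operation to a trace-preserving one; it annihilates
  -- every `M k`, hence everything the errors produce from the code.
  refine C.corrects_of_forall_exists _
    (fun k : Option (Fin C.dimB × κ) => k.elim (1 - Q) fun k => J * (V k)ᴴ) ?_ ?_
  · rw [Fintype.sum_option]
    simp only [Option.elim]
    have h1 : ∀ k, (J * (V k)ᴴ)ᴴ * (J * (V k)ᴴ) = V k * (V k)ᴴ := by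
      intro k
      calc (J * (V k)ᴴ)ᴴ * (J * (V k)ᴴ) = V k * (Jᴴ * J) * (V k)ᴴ := by
            simp only [Matrix.conjTranspose_mul, Matrix.conjTranspose_conjTranspose,
              Matrix.mul_assoc]
        _ = _ := by rw [hJ, Matrix.mul_one]
    rw [Finset.sum_congr rfl fun k _ => h1 k, Matrix.conjTranspose_sub, Matrix.conjTranspose_one,
      hQ]
    change (1 - Q) * (1 - Q) + Q = 1
    rw [mul_sub, sub_mul, one_mul, mul_one, sub_mul, one_mul, hV2]
    abel
  · rintro k _ ⟨i, rfl⟩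
    have hcol : ∀ (T : Matrix ι ι ℂ) (u : ι) (a : Fin C.dimA) (b : Fin C.dimB),
        (T * E i * C.enc) u (a, b) = ∑ k, (T * M k) u a * star (U (b, i) k) := by
      intro T u a b
      rw [Matrix.mul_assoc, Matrix.mul_apply]
      simp only [hEV, Finset.mul_sum, Matrix.mul_apply, Finset.sum_mul]
      rw [Finset.sum_comm]
      simp only [mul_assoc]
    rcases k with _ | k
    · refine ⟨0, ?_⟩
      rw [Matrix.kronecker_zero, Matrix.mul_zero]
      ext u ⟨a, b⟩
      rw [hcol]
      refine Finset.sum_eq_zero fun l _ => ?_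
      have : (1 - Q) * M l = 0 := by rw [Matrix.sub_mul, Matrix.one_mul, hV1, sub_self]
      simp only [Option.elim]
      rw [this, Matrix.zero_apply, zero_mul]
    · refine ⟨Matrix.of fun b' b => if b' = b₀ then c k * star (U (b, i) k) else 0, ?_⟩
      ext u ⟨a, b⟩
      rw [hcol]
      simp only [Option.elim, Matrix.mul_assoc, hV3]
      rw [Finset.sum_eq_single k, if_pos rfl, Matrix.mul_smul, Matrix.mul_one, Matrix.mul_apply,
        Fintype.sum_prod_type,
        Finset.sum_eq_single a, Finset.sum_eq_single b₀]
      · simp only [J, Matrix.smul_apply, Matrix.of_apply, Matrix.kroneckerMap_apply,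
          Matrix.one_apply_eq, one_mul, if_true, smul_eq_mul]
        ring
      · intro b' _ hb
        simp [hb]
      · simp
      · intro a' _ ha
        simp [ha]
      · simp
      · intro l _ hl
        simp [hl.symm]
      · simp

theorem Corrects.mono {C : OQECC ι} {S T : Set (Matrix ι ι ℂ)} (h : C.Corrects T)
    (hST : S ⊆ Submodule.span ℂ T) : C.Corrects S := by
  obtain ⟨m, R, hR, h⟩ := h
  exact ⟨m, R, hR, fun K hK => h K (Submodule.span_le.2 hST hK)⟩

end OQECC

/-- The eigenvalues of a projection are `0` and `1`; the columns of `f` are the eigenvectors for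
`1`. -/
theorem exists_isometry_of_projection {ι : Type*} [Fintype ι] [DecidableEq ι] {P : Matrix ι ι ℂ}
    (hP : P.IsHermitian) (h2 : P * P = P) :
    ∃ (d : ℕ) (f : Matrix ι (Fin d) ℂ), fᴴ * f = 1 ∧ f * fᴴ = P := by
  classical
  let U : Matrix ι ι ℂ := hP.eigenvectorUnitary
  have hU : Uᴴ * U = 1 := Matrix.mem_unitaryGroup_iff'.1 hP.eigenvectorUnitary.2
  let D : Matrix ι ι ℂ := Matrix.diagonal (fun k => (hP.eigenvalues k : ℂ))
  have hspec : P = U * D * Uᴴ := by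
    have := hP.spectral_theorem
    rw [Unitary.conjStarAlgAut_apply] at this
    exact this
  have hD : D = Uᴴ * P * U := by
    calc D = (Uᴴ * U) * D * (Uᴴ * U) := by rw [hU, Matrix.one_mul, Matrix.mul_one]
      _ = Uᴴ * (U * D * Uᴴ) * U := by simp only [Matrix.mul_assoc]
      _ = _ := by rw [← hspec]
  have hDD : D * D = D := by
    calc D * D = Uᴴ * (U * D * Uᴴ) * U * D := by
          rw [← hspec, ← hD]
      _ = Uᴴ * (U * D * Uᴴ) * (U * D * Uᴴ) * U := by
          calc _ = Uᴴ * (U * D * Uᴴ) * (U * D * (Uᴴ * U)) := by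
                rw [hU, Matrix.mul_one]; simp only [Matrix.mul_assoc]
            _ = _ := by simp only [Matrix.mul_assoc]
      _ = D := by rw [← hspec, Matrix.mul_assoc Uᴴ P P, h2, ← hD]
  have heig : ∀ k, (hP.eigenvalues k : ℂ) = if hP.eigenvalues k = 1 then 1 else 0 := by
    intro k
    have h := congrFun (congrFun hDD k) k
    simp only [D, Matrix.diagonal_mul_diagonal, Matrix.diagonal_apply_eq] at h
    have h' : hP.eigenvalues k * hP.eigenvalues k = hP.eigenvalues k := by exact_mod_cast h
    split_ifs with h1
    · rw [h1, Complex.ofReal_one]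
    · rw [Complex.ofReal_eq_zero]
      by_contra h0
      exact h1 ((mul_eq_left₀ h0).1 h')
  let e := Fintype.equivFin {k // hP.eigenvalues k = 1}
  refine ⟨_, Matrix.of fun u k => U u (e.symm k).1, ?_, ?_⟩
  · ext i j
    have h := congrFun (congrFun hU (e.symm i).1) (e.symm j).1
    rw [Matrix.one_apply] at h ⊢
    simp only [Subtype.ext_iff.symm, e.symm.injective.eq_iff] at h
    exact h
  · ext u v
    have hPuv : P u v = ∑ k, if hP.eigenvalues k = 1 then U u k * star (U v k) else 0 := by
      have h := congrFun (congrFun hspec u) v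
      rw [h, Matrix.mul_apply]
      refine Finset.sum_congr rfl fun k _ => ?_
      rw [Matrix.mul_diagonal, heig k, Matrix.conjTranspose_apply]
      split_ifs <;> ring
    rw [hPuv, ← Finset.sum_filter]
    exact (Equiv.sum_comp e.symm fun k => U u k.1 * star (U v k.1)).trans
      (Finset.sum_subtype _ (by simp) fun k => U u k * star (U v k)).symm

/-! ### The stabilizer construction. -/

section

variable (p : ℕ) [Fact p.Prime] {F : Type*} [Field F] [Fintype F] [DecidableEq F]
    [Algebra (ZMod p) F] {n : ℕ}

/-- The projector onto the eigenspace is the average `P` of `star (χ l) • weyl p l` over `L`. Traces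
of compressions reduce to traces of `weyl` operators, of which only the one at `0` survives: this
gives the dimension, and the vanishing for `w ∉ L`. For `w ∈ L^⊥` the operator commutes with `P`, so
it preserves the eigenspace. -/
theorem exists_joint_eigenbasis {L : AddSubgroup ((Fin n → F) × (Fin n → F))}
    (hL : L ≤ sdual p L) :
    ∃ (d : ℕ) (f : Matrix (Fin n → F) (Fin d) ℂ) (χ : (Fin n → F) × (Fin n → F) → ℂ),
      fᴴ * f = 1 ∧ d * Nat.card L = Fintype.card F ^ n ∧
      (∀ l ∈ L, star (χ l) * χ l = 1) ∧ (∀ l ∈ L, weyl p l * f = χ l • f) ∧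
      (∀ w ∉ L, (fᴴ * weyl p w * f).trace = 0) ∧
      ∀ w ∈ sdual p L, weyl p w * f = f * (fᴴ * weyl p w * f) := by
  classical
  obtain ⟨χ, hχ0, hχn, hχ⟩ := exists_eigenvalues_weyl p hL
  have hχn' : ∀ l ∈ L, χ l * star (χ l) = 1 := fun l hl => by rw [mul_comm, hχn l hl]
  have hN : (Nat.card L : ℂ) ≠ 0 := by exact_mod_cast Nat.card_pos.ne'
  let S : Matrix (Fin n → F) (Fin n → F) ℂ := ∑ l : L, star (χ l) • weyl p l.1
  let P : Matrix (Fin n → F) (Fin n → F) ℂ := (Nat.card L : ℂ)⁻¹ • S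
  -- The multiplication rule for `χ` in the form that lets `weyl p u` permute the terms of `S` up to
  -- the factor `χ u`.
  have hphase : ∀ u ∈ L, ∀ v ∈ L, star (χ v) * weylPhase p u v = χ u * star (χ (u + v)) := by
    intro u hu v hv
    calc star (χ v) * weylPhase p u v
        = star (χ v) * weylPhase p u v * (χ (u + v) * star (χ (u + v))) := by
          rw [hχn' _ (add_mem hu hv), mul_one]
      _ = star (χ v) * (weylPhase p u v * χ (u + v)) * star (χ (u + v)) := by ring
      _ = (star (χ v) * χ v) * χ u * star (χ (u + v)) := by rw [← hχ u hu v hv]; ring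
      _ = _ := by rw [hχn v hv, one_mul]
  have hS : ∀ l ∈ L, weyl p l * S = χ l • S := by
    intro l hl
    simp only [S, Matrix.mul_sum, Matrix.mul_smul, weyl_mul_weyl, smul_smul, Finset.smul_sum]
    rw [← Equiv.sum_comp (Equiv.addLeft (⟨l, hl⟩ : L))
      (fun v : L => (χ l * star (χ v)) • weyl p v.1)]
    refine Finset.sum_congr rfl fun v _ => ?_
    rw [hphase l hl v v.2]
    rfl
  have hP : ∀ l ∈ L, weyl p l * P = χ l • P := by
    intro l hl
    simp only [P, Matrix.mul_smul, hS l hl]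
    rw [smul_comm]
  have hPP : P * P = P := by
    conv_lhs => enter [1]; simp only [P, S]
    simp only [Matrix.smul_mul, Matrix.sum_mul]
    have : ∀ l : L, star (χ l) • (weyl p l.1 * P) = P := fun l => by
      rw [hP l l.2, smul_smul, hχn l l.2, one_smul]
    rw [Finset.sum_congr rfl fun l _ => this l, Finset.sum_const, Finset.card_univ,
      ← Nat.card_eq_fintype_card, ← Nat.cast_smul_eq_nsmul ℂ, smul_smul, inv_mul_cancel₀ hN,
      one_smul]
  have hSH : Sᴴ = S := by
    simp only [S, Matrix.conjTranspose_sum, Matrix.conjTranspose_smul, star_star,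
      weyl_conjTranspose, smul_smul]
    rw [← Equiv.sum_comp (Equiv.neg L) (fun v : L => (star (χ v)) • weyl p v.1)]
    refine Finset.sum_congr rfl fun v _ => ?_
    congr 1
    have h := hphase v v.2 (-v.1) (neg_mem v.2)
    rw [add_neg_cancel, hχ0, star_one, mul_one] at h
    have h2 : weylPhase p v.1 (-v.1) * weylPhase p v.1 v.1 = 1 := by
      rw [weylPhase, weylPhase, ← AddChar.map_add_eq_mul, ← map_add, Prod.fst_neg, dotProduct_neg,
        neg_add_cancel, map_zero, AddChar.map_zero_eq_one]
    rw [← h, mul_assoc, h2, mul_one]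
    rfl
  have hPH : P.IsHermitian := by
    simp [Matrix.IsHermitian, P, Matrix.conjTranspose_smul, hSH]
  obtain ⟨d, f, hf, hfP⟩ := exists_isometry_of_projection hPH hPP
  have htr : ∀ T : Matrix (Fin n → F) (Fin n → F) ℂ, (fᴴ * T * f).trace =
      (Nat.card L : ℂ)⁻¹ * ∑ l : L, star (χ l) * (weyl p l.1 * T).trace := by
    intro T
    rw [Matrix.trace_mul_comm, ← Matrix.mul_assoc, hfP]
    simp only [P, S, Matrix.smul_mul, Matrix.sum_mul, Matrix.trace_smul, Matrix.trace_sum,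
      smul_eq_mul]
  have hPf : P * f = f := by rw [← hfP, Matrix.mul_assoc, hf, Matrix.mul_one]
  refine ⟨d, f, χ, hf, ?_, hχn, ?_, ?_, ?_⟩
  · have h := htr 1
    rw [Matrix.mul_one, hf, Matrix.trace_one, Fintype.card_fin,
      Finset.sum_eq_single (0 : L)] at h
    · rw [ZeroMemClass.coe_zero, hχ0, Matrix.mul_one, trace_weyl, if_pos rfl, star_one,
        one_mul] at h
      have h' : (d : ℂ) * Nat.card L = (Fintype.card F : ℂ) ^ n := by
        rw [h]; field_simp
      exact_mod_cast h'
    · intro l _ hl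
      rw [Matrix.mul_one, trace_weyl, if_neg (mt ZeroMemClass.coe_eq_zero.1 hl), mul_zero]
    · simp
  · intro l hl
    calc weyl p l * f = weyl p l * P * f := by rw [Matrix.mul_assoc, hPf]
      _ = χ l • f := by rw [hP l hl, Matrix.smul_mul, hPf]
  · intro w hw
    rw [htr, Finset.sum_eq_zero, mul_zero]
    intro l _
    rw [weyl_mul_weyl, Matrix.trace_smul, trace_weyl, if_neg, smul_zero, mul_zero]
    intro h
    exact hw (by rw [eq_neg_of_add_eq_zero_right h]; exact neg_mem l.2)
  · intro w hw
    have hc : weyl p w * P = P * weyl p w := by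
      simp only [P, S, Matrix.mul_smul, Matrix.smul_mul, Matrix.mul_sum, Matrix.sum_mul]
      congr 1
      refine Finset.sum_congr rfl fun l _ => ?_
      rw [weyl_commute p l.1 w, hw l.1 l.2, AddChar.map_zero_eq_one, one_smul]
    calc weyl p w * f = weyl p w * P * f := by rw [Matrix.mul_assoc, hPf]
      _ = f * (fᴴ * weyl p w * f) := by rw [hc, ← hfP]; simp only [Matrix.mul_assoc]

/-- Representatives of `X / L`; they will index a basis of `B`. -/
theorem exists_coset_representatives {A : Type*} [AddCommGroup A] [Finite A]
    {L X : AddSubgroup A} (hLX : L ≤ X) :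
    ∃ (m : ℕ) (σ : Fin m → A), m * Nat.card L = Nat.card X ∧ (∀ i, σ i ∈ X) ∧
      (∀ i j, σ i - σ j ∈ L → i = j) ∧ ∀ x ∈ X, ∃ i, x - σ i ∈ L := by
  let e : (X ⧸ L.addSubgroupOf X) ≃ Fin (Nat.card (X ⧸ L.addSubgroupOf X)) :=
    Finite.equivFin _
  refine ⟨_, fun i => ((e.symm i).out : X).1, ?_, fun i => ((e.symm i).out : X).2, ?_, ?_⟩
  · rw [AddSubgroup.card_eq_card_quotient_mul_card_addSubgroup (L.addSubgroupOf X)]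
    congr 1
    exact Nat.card_congr (AddSubgroup.addSubgroupOfEquivOfLe hLX).symm.toEquiv
  · intro i j h
    apply e.symm.injective
    rw [← QuotientAddGroup.out_eq' (e.symm i), ← QuotientAddGroup.out_eq' (e.symm j), eq_comm,
      QuotientAddGroup.eq, AddSubgroup.mem_addSubgroupOf]
    simpa [sub_eq_neg_add] using h
  · intro x hx
    refine ⟨e (QuotientAddGroup.mk (⟨x, hx⟩ : X)), ?_⟩
    have h := QuotientAddGroup.out_eq' (QuotientAddGroup.mk (⟨x, hx⟩ : X) : X ⧸ L.addSubgroupOf X)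
    rw [QuotientAddGroup.eq, AddSubgroup.mem_addSubgroupOf] at h
    simpa [sub_eq_neg_add] using h

theorem weyl_conjTranspose_mul_mul (r v s : (Fin n → F) × (Fin n → F)) :
    ∃ c : ℂ, c ≠ 0 ∧ (weyl p r)ᴴ * weyl p v * weyl p s = c • weyl p (v + s - r) := by
  refine ⟨weylPhase p r r * weylPhase p (-r) v * weylPhase p (-r + v) s,
    mul_ne_zero (mul_ne_zero (weylPhase_ne_zero p _ _) (weylPhase_ne_zero p _ _))
      (weylPhase_ne_zero p _ _), ?_⟩
  rw [weyl_conjTranspose, Matrix.smul_mul, weyl_mul_weyl, Matrix.smul_mul, Matrix.smul_mul,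
    weyl_mul_weyl, smul_smul, smul_smul, show -r + v + s = v + s - r by abel]

/-- The stabilizer construction of an operator quantum error-correcting code from an additive
code `X`, together with its detectable errors. -/
theorem exists_code_detects_iff (X : AddSubgroup ((Fin n → F) × (Fin n → F))) :
    ∃ (C : OQECC (Fin n → F)) (N : ℕ),
      N ^ 2 = Nat.card X * Nat.card (X ⊓ sdual p X : AddSubgroup _) ∧
      C.dimA * N = Fintype.card F ^ n ∧ C.dimB * N = Nat.card X ∧
      ∀ v, C.Detects (weyl p v) ↔ ¬ (v ∈ X ⊔ sdual p X ∧ v ∉ X) := by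
  classical
  obtain ⟨L, hYL, hLX, hXL⟩ := exists_maximal_isotropic (p := p) X
  have hL : L ≤ sdual p L := le_of_eq_of_le hXL.symm inf_le_right
  obtain ⟨d, f, χ, hf, hd, hχn, hχ, htr, hcomm⟩ := exists_joint_eigenbasis p hL
  obtain ⟨m, σ, hm, hσX, hσinj, hσsurj⟩ := exists_coset_representatives hLX
  have hd0 : 0 < d := by
    rcases Nat.eq_zero_or_pos d with h | h
    · rw [h, zero_mul] at hd
      exact absurd hd.symm (pow_ne_zero _ Fintype.card_ne_zero)
    · exact h
  have hmem : ∀ u ∈ L, fᴴ * weyl p u * f = χ u • 1 := by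
    intro u hu
    rw [Matrix.mul_assoc, hχ u hu, Matrix.mul_smul, hf]
  have hfL : ∀ l ∈ L, fᴴ * weyl p l = χ l • fᴴ := by
    intro l hl
    have h1 : (weyl p l)ᴴ * f = star (χ l) • f := by
      calc (weyl p l)ᴴ * f = (star (χ l) * χ l) • ((weyl p l)ᴴ * f) := by rw [hχn l hl, one_smul]
        _ = star (χ l) • ((weyl p l)ᴴ * (weyl p l * f)) := by
          rw [hχ l hl, Matrix.mul_smul, smul_smul]
        _ = _ := by rw [← Matrix.mul_assoc, weyl_conjTranspose_mul_self, Matrix.one_mul]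
    have h2 := congrArg Matrix.conjTranspose h1
    simpa [Matrix.conjTranspose_mul, Matrix.conjTranspose_smul] using h2
  -- Some `l ∈ L` fails to commute with `u`: moving `weyl p l` across `weyl p u` multiplies the
  -- block by a phase other than `1`, yet both sides give the eigenvalue `χ l`.
  have hnot : ∀ u ∉ sdual p L, fᴴ * weyl p u * f = 0 := by
    intro u hu
    rw [mem_sdual] at hu
    push Not at hu
    obtain ⟨l, hl, hlu⟩ := hu
    have h1 : fᴴ * (weyl p l * weyl p u) * f = χ l • (fᴴ * weyl p u * f) := by
      rw [← Matrix.mul_assoc, hfL l hl, Matrix.smul_mul, Matrix.smul_mul]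
    rw [weyl_commute, Matrix.mul_smul, Matrix.smul_mul, ← Matrix.mul_assoc, Matrix.mul_assoc,
      hχ l hl, Matrix.mul_smul, smul_smul] at h1
    have h2 : χ l ≠ 0 := fun h => by
      have := hχn l hl
      rw [h, mul_zero] at this
      exact zero_ne_one this
    have h3 : (ZMod.stdAddChar (sform p l u) : ℂ) ≠ 1 := by
      rw [← AddChar.map_zero_eq_one (ZMod.stdAddChar (N := p))]
      exact fun h => hlu (ZMod.injective_stdAddChar h)
    rw [← sub_eq_zero, ← sub_smul] at h1
    refine (smul_eq_zero.1 h1).resolve_left ?_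
    rw [← sub_one_mul]
    exact mul_ne_zero (sub_ne_zero.2 h3) h2
  -- The copies of the eigenspace translated by the `σ i`, side by side: the first index is `A`, the
  -- second `B`.
  let V : Matrix (Fin n → F) (Fin d × Fin m) ℂ := Matrix.of fun u x => (weyl p (σ x.2) * f) u x.1
  have hblock : ∀ (T : Matrix (Fin n → F) (Fin n → F) ℂ) (a b : Fin d) (i j : Fin m),
      (Vᴴ * T * V) (a, i) (b, j) = (fᴴ * ((weyl p (σ i))ᴴ * T * weyl p (σ j)) * f) a b := by
    intro T a b i j
    have : fᴴ * ((weyl p (σ i))ᴴ * T * weyl p (σ j)) * f =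
        (weyl p (σ i) * f)ᴴ * T * (weyl p (σ j) * f) := by
      simp only [Matrix.conjTranspose_mul, Matrix.mul_assoc]
    rw [this]
    rfl
  have hV : Vᴴ * V = 1 := by
    ext ⟨a, i⟩ ⟨b, j⟩
    have h := hblock 1 a b i j
    rw [Matrix.mul_one] at h
    rw [h]
    by_cases hij : i = j
    · subst hij
      rw [Matrix.mul_one, weyl_conjTranspose_mul_self, Matrix.mul_one, hf]
      simp [Matrix.one_apply]
    · obtain ⟨c, -, hc⟩ := weyl_conjTranspose_mul_mul p (σ i) 0 (σ j)
      rw [weyl_zero] at hc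
      rw [hc, Matrix.mul_smul, Matrix.smul_mul, hnot, smul_zero, Matrix.one_apply_ne, Matrix.zero_apply]
      · simp [hij]
      · intro h
        refine hij (hσinj j i ?_).symm
        rw [zero_add] at h
        rw [← hXL]
        exact AddSubgroup.mem_inf.2 ⟨sub_mem (hσX j) (hσX i), h⟩
  refine ⟨⟨d, m, V, hV⟩, Nat.card L, card_sq_of_maximal_isotropic hYL hLX hXL, hd, hm, ?_⟩
  intro v
  rw [OQECC.detects_iff]
  change (∃ g : Matrix (Fin m) (Fin m) ℂ, Vᴴ * weyl p v * V =
    (1 : Matrix (Fin d) (Fin d) ℂ) ⊗ₖ g) ↔ _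
  choose c hc0 hc using weyl_conjTranspose_mul_mul p (n := n) (F := F)
  constructor
  · rintro ⟨g, hg⟩ ⟨hv, hvX⟩
    obtain ⟨x, hx, w, hw, rfl⟩ := AddSubgroup.mem_sup.1 hv
    -- Any column `j` would do; the class of `0` supplies one. Then `i` is chosen as the class of `x
    -- + σ j`, so that `u` is congruent to `w` modulo `L` and thus lies in `L^⊥ \ L`.
    obtain ⟨j, hj⟩ := hσsurj 0 (zero_mem X)
    obtain ⟨i, hi⟩ := hσsurj (x + σ j) (add_mem hx (hσX j))
    let u := x + w + σ j - σ i
    have hu : u = w + (x + σ j - σ i) := by simp only [u]; abel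
    have hwX : w ∉ X := fun h => hvX (add_mem hx h)
    have huL : u ∉ L := by
      rw [hu]
      exact fun h => hwX (hLX ((add_mem_cancel_right hi).1 h))
    have huL' : u ∈ sdual p L := by
      rw [hu]
      exact add_mem (sdual_anti hLX hw) (hL hi)
    let k := c (σ i) (x + w) (σ j)
    have hM : fᴴ * weyl p u * f = (k⁻¹ * g i j) • 1 := by
      ext a b
      have h := congrFun (congrFun hg (a, i)) (b, j)
      rw [hblock, hc, Matrix.mul_smul, Matrix.smul_mul, Matrix.smul_apply] at h
      have hk : k ≠ 0 := hc0 _ _ _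
      change k * (fᴴ * weyl p u * f) a b =
        (1 : Matrix (Fin d) (Fin d) ℂ) a b * g i j at h
      rw [Matrix.smul_apply, smul_eq_mul, mul_assoc, mul_comm (g i j), ← h,
        inv_mul_cancel_left₀ hk]
    -- A scalar block of trace zero vanishes; but `weyl p u` preserves the nonzero range of `f` and
    -- is invertible.
    have h0 : k⁻¹ * g i j = 0 := by
      have h := htr u huL
      rw [hM, Matrix.trace_smul, Matrix.trace_one, Fintype.card_fin, smul_eq_mul] at h
      exact (mul_eq_zero.1 h).resolve_right (by exact_mod_cast hd0.ne')
    have h1 : weyl p u * f = 0 := by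
      rw [hcomm u huL', hM, h0, zero_smul, Matrix.mul_zero]
    have h2 : f = 0 := by
      rw [← Matrix.one_mul f, ← weyl_conjTranspose_mul_self p u, Matrix.mul_assoc, h1,
        Matrix.mul_zero]
    have h3 := congrFun (congrFun hf ⟨0, hd0⟩) ⟨0, hd0⟩
    rw [h2, Matrix.mul_zero, Matrix.one_apply_eq] at h3
    exact zero_ne_one h3
  · intro hv
    have hscalar : ∀ i j, ∃ γ : ℂ, fᴴ * weyl p (v + σ j - σ i) * f = γ • 1 := by
      intro i j
      -- Here `L^⊥ ≤ Y^⊥ = X + X^⊥`, so a block index in `L^⊥` forces `v ∈ X + X^⊥`, hence `v ∈ X`,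
      -- and the index is then in `X ∩ L^⊥ = L`.
      by_cases h1 : v + σ j - σ i ∈ sdual p L
      · have h2 : v ∈ X ⊔ sdual p X := by
          rw [← sdual_inf_sdual]
          have h3 := sdual_anti hYL h1
          rw [sdual_inf_sdual] at h3 ⊢
          have h4 : σ i - σ j ∈ X ⊔ sdual p X :=
            AddSubgroup.mem_sup_left (sub_mem (hσX i) (hσX j))
          have : v = (v + σ j - σ i) + (σ i - σ j) := by abel
          rw [this]
          exact add_mem h3 h4
        have h3 : v ∈ X := by
          by_contra h
          exact hv ⟨h2, h⟩
        refine ⟨_, hmem _ ?_⟩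
        rw [← hXL]
        exact AddSubgroup.mem_inf.2 ⟨sub_mem (add_mem h3 (hσX j)) (hσX i), h1⟩
      · exact ⟨0, by rw [hnot _ h1, zero_smul]⟩
    choose γ hγ using hscalar
    refine ⟨Matrix.of fun i j => c (σ i) v (σ j) * γ i j, ?_⟩
    ext ⟨a, i⟩ ⟨b, j⟩
    rw [hblock, hc, Matrix.mul_smul, Matrix.smul_mul, hγ]
    simp only [Matrix.smul_apply, smul_eq_mul, Matrix.kroneckerMap_apply, Matrix.of_apply]
    ring

end

/-! ### Minimum distance and the theorem. -/

theorem minDist_eq_swtMin (p : ℕ) [Fact p.Prime] {F : Type*} [Field F] [Fintype F] [DecidableEq F]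
    [Algebra (ZMod p) F] {n : ℕ} (C : OQECC (Fin n → F)) (S : Set ((Fin n → F) × (Fin n → F)))
    (hS : ∀ v, C.Detects (weyl p v) ↔ v ∉ S) : C.minDist p = swtMin S := by
  apply le_antisymm
  · refine le_iInf₂ fun v hv => ?_
    obtain ⟨e, he, hev⟩ := exists_mem_errorGroup_eq_weyl p v
    have hne : ¬ C.Detects (e : Matrix (Fin n → F) (Fin n → F) ℂ) := by
      rw [hev, hS]
      exact not_not.2 hv
    refine (iInf₂_le e ⟨he, hne⟩).trans ?_
    rw [hev, errWeight_weyl]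
  · refine le_iInf₂ ?_
    rintro e ⟨he, hne⟩
    obtain ⟨α, v, hα, hev⟩ := exists_smul_weyl_of_mem_errorGroup p he
    rw [hev, C.detects_smul_iff hα, hS, not_not] at hne
    rw [hev, errWeight_smul_weyl p hα]
    exact iInf₂_le v hne

theorem detects_of_errWeight_lt_minDist {p : ℕ} [Fact p.Prime] {F : Type*} [Field F] [Fintype F]
    [DecidableEq F] [Algebra (ZMod p) F] {n : ℕ} (C : OQECC (Fin n → F))
    {e : Matrix.unitaryGroup (Fin n → F) ℂ} (he : e ∈ errorGroup p F n)
    (h : (errWeight p (e : Matrix (Fin n → F) (Fin n → F) ℂ) : ℕ∞) < C.minDist p) :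
    C.Detects (e : Matrix (Fin n → F) (Fin n → F) ℂ) := by
  by_contra hne
  exact h.not_ge (iInf₂_le e ⟨he, hne⟩)

/-- The products `(weyl p u)ᴴ * weyl p v` with `u`, `v` of weight at most `t` have weight at most `2
* t`, below the distance, so they are detectable. Up to scalars these `weyl` operators are all the
errors in question. -/
theorem corrects_of_le_minDist {p : ℕ} [Fact p.Prime] {F : Type*} [Field F] [Fintype F]
    [DecidableEq F] [Algebra (ZMod p) F] {n : ℕ} (C : OQECC (Fin n → F)) (hA : 0 < C.dimA)
    (hB : 0 < C.dimB) {t : ℕ} (ht : ((2 * t + 1 : ℕ) : ℕ∞) ≤ C.minDist p) :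
    C.Corrects {M | ∃ e ∈ errorGroup p F n,
      M = (e : Matrix (Fin n → F) (Fin n → F) ℂ) ∧ errWeight p M ≤ t} := by
  classical
  have h := C.corrects_range_of_forall_detects hA hB
    (fun v : {v : (Fin n → F) × (Fin n → F) // swt v ≤ t} => weyl p v.1) ?_
  · refine h.mono ?_
    rintro _ ⟨e, he, rfl, hw⟩
    obtain ⟨α, v, hα, hev⟩ := exists_smul_weyl_of_mem_errorGroup p he
    rw [hev, errWeight_smul_weyl p hα] at hw
    rw [hev]
    exact Submodule.smul_mem _ _ (Submodule.subset_span ⟨⟨v, hw⟩, rfl⟩)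
  · rintro ⟨u, hu⟩ ⟨v, hv⟩
    simp only
    rw [weyl_conjTranspose, Matrix.smul_mul, weyl_mul_weyl]
    refine OQECC.Detects.smul (OQECC.Detects.smul ?_ _) _
    obtain ⟨e, he, hev⟩ := exists_mem_errorGroup_eq_weyl p (-u + v)
    rw [← hev]
    refine detects_of_errWeight_lt_minDist C he (lt_of_lt_of_le ?_ ht)
    rw [hev, errWeight_weyl, Nat.cast_lt]
    have := swt_add_le (-u) v
    rw [swt_neg] at this
    omega

theorem theorem4 {p : ℕ} [Fact p.Prime] {F : Type*} [Field F] [Fintype F] [DecidableEq F]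
    [Algebra (ZMod p) F] {n : ℕ} (X Y : AddSubgroup ((Fin n → F) × (Fin n → F)))
    (hX : X ≠ ⊥) (hY : Y = X ⊓ sdual p X) :
    ∃ C : OQECC (Fin n → F),
      (C.dimA : ℝ) = (Fintype.card F : ℝ) ^ n / √((Nat.card X : ℝ) * (Nat.card Y : ℝ)) ∧
      (C.dimB : ℝ) = √((Nat.card X : ℝ) / (Nat.card Y : ℝ)) ∧
      C.minDist p = swtMin (((X ⊔ sdual p X : AddSubgroup ((Fin n → F) × (Fin n → F))) :
        Set ((Fin n → F) × (Fin n → F))) \ (X : Set ((Fin n → F) × (Fin n → F)))) ∧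
      C.minDist p = swtMin ((sdual p Y : Set ((Fin n → F) × (Fin n → F))) \
        (X : Set ((Fin n → F) × (Fin n → F)))) ∧
      (∀ e ∈ errorGroup p F n,
        (errWeight p (e : Matrix (Fin n → F) (Fin n → F) ℂ) : ℕ∞) < C.minDist p →
          C.Detects (e : Matrix (Fin n → F) (Fin n → F) ℂ)) ∧
      (∀ t : ℕ, ((2 * t + 1 : ℕ) : ℕ∞) ≤ C.minDist p →
        C.Corrects {M | ∃ e ∈ errorGroup p F n,
          M = (e : Matrix (Fin n → F) (Fin n → F) ℂ) ∧ errWeight p M ≤ t}) := by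
  subst hY
  obtain ⟨C, N, hN, hdA, hdB, hdet⟩ := exists_code_detects_iff p X
  have hx : 0 < Nat.card X := Nat.card_pos
  have hy : 0 < Nat.card (X ⊓ sdual p X : AddSubgroup _) := Nat.card_pos
  have hN0 : 0 < N := Nat.pos_of_ne_zero fun h => by
    rw [h, zero_pow two_ne_zero] at hN
    exact (Nat.mul_pos hx hy).ne hN
  have hA : 0 < C.dimA := Nat.pos_of_ne_zero fun h => by
    rw [h, zero_mul] at hdA
    exact pow_ne_zero _ Fintype.card_ne_zero hdA.symm
  have hB : 0 < C.dimB := Nat.pos_of_ne_zero fun h => by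
    rw [h, zero_mul] at hdB
    exact hx.ne hdB
  have hmin := minDist_eq_swtMin p C
    (((X ⊔ sdual p X : AddSubgroup ((Fin n → F) × (Fin n → F))) :
      Set ((Fin n → F) × (Fin n → F))) \ (X : Set ((Fin n → F) × (Fin n → F)))) hdet
  have hN0' : (N : ℝ) ≠ 0 := by exact_mod_cast hN0.ne'
  have hy' : (Nat.card (X ⊓ sdual p X : AddSubgroup _) : ℝ) ≠ 0 := by exact_mod_cast hy.ne'
  have hNR : (N : ℝ) ^ 2 = Nat.card X * Nat.card (X ⊓ sdual p X : AddSubgroup _) := by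
    exact_mod_cast hN
  have hdBR : (C.dimB : ℝ) * N = Nat.card X := by exact_mod_cast hdB
  refine ⟨C, ?_, ?_, hmin, ?_, fun e he h => detects_of_errWeight_lt_minDist C he h,
    fun t ht => corrects_of_le_minDist C hA hB ht⟩
  · rw [← hNR, Real.sqrt_sq (Nat.cast_nonneg N), eq_div_iff hN0']
    exact_mod_cast hdA
  -- From `N² = x y` and `dim B * N = x` one gets `(dim B)² = x / y` after cancelling `N`.
  · symm
    rw [Real.sqrt_eq_iff_mul_self_eq (by positivity) (by positivity), div_eq_iff hy']
    rw [← hdBR] at hNR ⊢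
    apply mul_right_cancel₀ hN0'
    linear_combination (C.dimB : ℝ) * hNR
  · rw [sdual_inf_sdual]
    exact hmin

end
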